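/- Let $d\ge 0$, let $\Lambda=\Lambda_l(c)\subset\mathbb R^d$ be an open cube of side length $l>0$ centred at $c$, let $\tilde\Lambda=\Lambda\cap\mathbb Z^d$, and let $H_0^\Lambda$ be a self-adjoint restriction to $L^2(\Lambda)$, with periodic boundary conditions, of the Schrödinger operator $(-i\nabla-A_0)^2+V_0$, where $A_0\in L^2(\Lambda;\mathbb R^d)$ and $V_0$ is real-valued (the action of the operator being understood weakly, tested against smooth periodic functions). Let $u\in L^\infty(\mathbb R^d)$ with $0\le u\le 1$ almost everywhere, and write $u_j$ for (multiplication by) $u(\cdot-j)$. Let $(\omega_j)_{j\in\mathbb Z^d}$ be real random variables on a probability space $(\Omega,\mathbb P)$ with values almost surely in a fixed interval $[m_0,M_0]$, with no independence assumed. Put $$H_\Lambda=H_0^\Lambda+\sum_{k\in\tilde\Lambda}\omega_k u_k ,$$ let $H_{j^\perp}^\Lambda$ denote $H_\Lambda$ with $\omega_j$ replaced by $0$, and let $E_\Lambda(\cdot)$ be the spectral family of $H_\Lambda$. Let $\mu_j$ be the (regular) conditional distribution of $\omega_j$ given $(\omega_k)_{k\ne j}$, and for $\epsilon>0$ set $$s(\epsilon)=\sup_{j\in\mathbb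 Z^d}\mathbb E\Big\{\sup_{E\in\mathbb R}\mu_j([E,E+\epsilon])\Big\}.$$ Then for every $j\in\tilde\Lambda$, every $\phi\in L^2(\Lambda)$, every $\epsilon>0$ and every interval $\Delta_\epsilon\subset\mathbb R$ of length $\epsilon$, the integrals below exist (each iterated integral being absolutely convergent) and $$\mathbb E\Big\{\int_{\Delta_\epsilon}dE\int_{\mathbb R}d\mu_j(t)\ \mathrm{Im}\,\big\langle\phi,\,u_j\,(H_{j^\perp}^\Lambda+t\,u_j-E-i\epsilon)^{-1}u_j\,\phi\big\rangle\Big\}\le 2\pi\,s(\epsilon)\,\|\phi\|^2 ,$$ and moreover $$\mathbb E\big\{\langle\phi,\,u_j\,E_\Lambda(\Delta_\epsilon)\,u_j\,\phi\rangle\big\}\le 8\,s(\epsilon)\,\|\phi\|^2 .$$ -/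

import Mathlib

open MeasureTheory ProbabilityTheory Set
open scoped ENNReal ComplexConjugate

noncomputable section

namespace RandomSchrodinger

/-! ### Self-adjoint operators: resolvent and spectral family -/

section Operators

variable {𝓗 : Type*} [NormedAddCommGroup 𝓗] [InnerProductSpace ℂ 𝓗] [CompleteSpace 𝓗]

/-- `R` is the bounded two-sided inverse of `H - z`. -/
structure IsResolventAt (H : 𝓗 →ₗ.[ℂ] 𝓗) (z : ℂ) (R : 𝓗 →L[ℂ] 𝓗) : Prop where
  mem_domain : ∀ v, R v ∈ H.domain
  right_inv : ∀ v, H ⟨R v, mem_domain v⟩ - z • R v = v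
  left_inv : ∀ ψ : H.domain, R (H ψ - z • (ψ : 𝓗)) = ψ

open Classical in
/-- The resolvent `(H - z)⁻¹` (with value `0` when `z` lies in the spectrum of `H`; for
self-adjoint `H` every non-real `z` lies in the resolvent set). -/
def resolvent (H : 𝓗 →ₗ.[ℂ] 𝓗) (z : ℂ) : 𝓗 →L[ℂ] 𝓗 :=
  if h : ∃ R, IsResolventAt H z R then h.choose else 0

/-- `E` is the spectral family (projection-valued measure) of `H`, that is `H = ∫ x dE(x)`:
every `E S` is an orthogonal projection, `E` is multiplicative and normalized,
`S ↦ ⟨ψ, E S ψ⟩` is a measure for each `ψ`, the domain of `H` consists of the `ψ` with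
`∫ x² d⟨ψ, E ψ⟩ < ∞`, and `⟨ψ, H ψ⟩ = ∫ x d⟨ψ, E ψ⟩` for all `ψ` in the domain. -/
structure IsSpectralFamily (H : 𝓗 →ₗ.[ℂ] 𝓗) (E : Set ℝ → 𝓗 →L[ℂ] 𝓗) : Prop where
  isStarProjection : ∀ S, MeasurableSet S → IsStarProjection (E S)
  univ : E univ = 1
  inter : ∀ S T, MeasurableSet S → MeasurableSet T → E (S ∩ T) = E S * E T
  scalar : ∀ ψ : 𝓗, ∃ μ : Measure ℝ,
    (∀ S, MeasurableSet S → μ S = ENNReal.ofReal (inner ℂ ψ (E S ψ)).re) ∧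
    (ψ ∈ H.domain ↔ ∫⁻ x, ENNReal.ofReal (x ^ 2) ∂μ < ∞) ∧
    ∀ h : ψ ∈ H.domain, inner ℂ ψ (H ⟨ψ, h⟩) = ((∫ x, x ∂μ : ℝ) : ℂ)

open Classical in
/-- The spectral family `S ↦ E_H(S)` of a self-adjoint operator `H`.  By the spectral theorem it
exists and is unique on Borel sets when `H` is self-adjoint. -/
def spectralFamily (H : 𝓗 →ₗ.[ℂ] 𝓗) : Set ℝ → 𝓗 →L[ℂ] 𝓗 :=
  if h : ∃ E, IsSpectralFamily H E then h.choose else 0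

end Operators

/-! ### Cubes, lattice points and the periodic background operator -/

variable {d : ℕ}

/-- The open cube `Λ_l(c)` of side length `l` centred at `c`. -/
def cube (c : EuclideanSpace ℝ (Fin d)) (l : ℝ) : Set (EuclideanSpace ℝ (Fin d)) :=
  {x | ∀ i, |x i - c i| < l / 2}

/-- A point of `ℤ^d` as a vector of `ℝ^d`. -/
def latticePoint (j : Fin d → ℤ) : EuclideanSpace ℝ (Fin d) :=
  WithLp.toLp 2 fun i => (j i : ℝ)

/-- The finite set of lattice points in the cube, see `mem_latticePoints`. -/
def latticePoints (c : EuclideanSpace ℝ (Fin d)) (l : ℝ) : Finset (Fin d → ℤ) :=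
  Fintype.piFinset fun i => Finset.Ioo ⌊c i - l / 2⌋ ⌈c i + l / 2⌉

theorem mem_latticePoints (c : EuclideanSpace ℝ (Fin d)) (l : ℝ) (j : Fin d → ℤ) :
    j ∈ latticePoints c l ↔ latticePoint j ∈ cube c l := by
  simp only [latticePoints, Fintype.mem_piFinset, Finset.mem_Ioo, Int.floor_lt, Int.lt_ceil,
    cube, latticePoint, mem_ofPred_eq, abs_lt]
  refine forall_congr' fun i => ?_
  constructor <;> rintro ⟨h1, h2⟩ <;> constructor <;> linarith

/-- The Hilbert space `L²(Λ)` of the cube `Λ = Λ_l(c)`. -/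
abbrev L2 (c : EuclideanSpace ℝ (Fin d)) (l : ℝ) : Type :=
  Lp ℂ 2 (volume.restrict (cube c l))

/-- Smooth functions on `ℝ^d` that are `l`-periodic in every coordinate direction. -/
structure IsPeriodicTest (l : ℝ) (f : EuclideanSpace ℝ (Fin d) → ℂ) : Prop where
  smooth : ContDiff ℝ ((⊤ : ℕ∞) : WithTop ℕ∞) f
  periodic : ∀ (i : Fin d) x, f (x + EuclideanSpace.single i l) = f x

/-- The `k`-th component `(-i ∂_k - A_k) f` of the magnetic momentum of a smooth function. -/
def momentum (A : EuclideanSpace ℝ (Fin d) → EuclideanSpace ℝ (Fin d)) (k : Fin d)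
    (f : EuclideanSpace ℝ (Fin d) → ℂ) (x : EuclideanSpace ℝ (Fin d)) : ℂ :=
  -Complex.I * fderiv ℝ f x (EuclideanSpace.single k 1) - (A x k : ℂ) * f x

/-- `η = (-i ∂_k - A_k) ψ` on the cube, in the weak sense and with periodic boundary conditions:
the test functions are the smooth periodic functions. -/
def IsWeakMomentum (A : EuclideanSpace ℝ (Fin d) → EuclideanSpace ℝ (Fin d))
    (c : EuclideanSpace ℝ (Fin d)) (l : ℝ) (k : Fin d) (ψ η : L2 c l) : Prop :=
  ∀ f, IsPeriodicTest l f →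
    ∫ x in cube c l, conj (momentum A k f x) * ψ x = ∫ x in cube c l, conj (f x) * η x

/-- `g = ((-i∇ - A)² + V) ψ` on the cube with periodic boundary conditions, in the weak (form)
sense: `ψ` has a square-integrable weak periodic magnetic momentum `η`, and
`∑ k ⟨(-i ∂_k - A_k) f, η_k⟩ + ⟨f, V ψ⟩ = ⟨f, g⟩` for all smooth periodic `f`. -/
def IsWeakPeriodicAction (A : EuclideanSpace ℝ (Fin d) → EuclideanSpace ℝ (Fin d))
    (V : EuclideanSpace ℝ (Fin d) → ℝ) (c : EuclideanSpace ℝ (Fin d)) (l : ℝ)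
    (ψ g : L2 c l) : Prop :=
  ∃ η : Fin d → L2 c l, (∀ k, IsWeakMomentum A c l k ψ (η k)) ∧
    ∀ f, IsPeriodicTest l f →
      IntegrableOn (fun x => conj (f x) * ((V x : ℂ) * ψ x)) (cube c l) ∧
      (∑ k, ∫ x in cube c l, conj (momentum A k f x) * η k x)
        + (∫ x in cube c l, conj (f x) * ((V x : ℂ) * ψ x))
        = ∫ x in cube c l, conj (f x) * g x

/-- `H₀` is the operator `(-i∇ - A)² + V` restricted to the cube `Λ_l(c)` with periodic boundary
conditions: a self-adjoint operator in `L²(Λ_l(c))` acting by this expression. -/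
structure IsPeriodicRestriction (A : EuclideanSpace ℝ (Fin d) → EuclideanSpace ℝ (Fin d))
    (V : EuclideanSpace ℝ (Fin d) → ℝ) (c : EuclideanSpace ℝ (Fin d)) (l : ℝ)
    (H₀ : L2 c l →ₗ.[ℂ] L2 c l) : Prop where
  isSelfAdjoint : IsSelfAdjoint H₀
  action : ∀ ψ : H₀.domain, IsWeakPeriodicAction A V c l ψ (H₀ ψ)

/-! ### The random potential and the local Hamiltonian -/

theorem memLp_site {u : EuclideanSpace ℝ (Fin d) → ℝ} (hu : MemLp u ∞ volume)
    (c : EuclideanSpace ℝ (Fin d)) (l : ℝ) (j : Fin d → ℤ) :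
    MemLp (fun x => (u (x - latticePoint j) : ℂ)) ∞ (volume.restrict (cube c l)) :=
  ((hu.comp_measurePreserving (measurePreserving_sub_right volume (latticePoint j))).ofReal
    (K := ℂ)).restrict _

/-- The bounded operator `u_j` on `L²(Λ)`: multiplication by the translate `u(x - j)`. -/
def siteOp {u : EuclideanSpace ℝ (Fin d) → ℝ} (hu : MemLp u ∞ volume)
    (c : EuclideanSpace ℝ (Fin d)) (l : ℝ) (j : Fin d → ℤ) : L2 c l →L[ℂ] L2 c l :=
  (ContinuousLinearMap.mul ℂ ℂ).holderL (volume.restrict (cube c l)) ∞ 2 2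
    ((memLp_site hu c l j).toLp _)

/-- `H^Λ = H₀^Λ + V_Λ` with `V_Λ(x) = ∑ q_j u(x - j)`, the sum over the lattice points `j` in
`Λ`, for the configuration `q` of the couplings; its domain is that of `H₀^Λ`. -/
def hamiltonian {u : EuclideanSpace ℝ (Fin d) → ℝ} (hu : MemLp u ∞ volume)
    {c : EuclideanSpace ℝ (Fin d)} {l : ℝ} (H₀ : L2 c l →ₗ.[ℂ] L2 c l)
    (q : (Fin d → ℤ) → ℝ) : L2 c l →ₗ.[ℂ] L2 c l :=
  ((∑ j ∈ latticePoints c l, (q j : ℂ) • siteOp hu c l j : L2 c l →L[ℂ] L2 c l) :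
    L2 c l →ₗ[ℂ] L2 c l) +ᵥ H₀

/-- `H_{j^⊥}^Λ + t u_j`, where `H_{j^⊥}^Λ` is `H^Λ` with the coupling at `j` set to `0`. -/
def siteFamily {u : EuclideanSpace ℝ (Fin d) → ℝ} (hu : MemLp u ∞ volume)
    {c : EuclideanSpace ℝ (Fin d)} {l : ℝ} (H₀ : L2 c l →ₗ.[ℂ] L2 c l)
    (q : (Fin d → ℤ) → ℝ) (j : Fin d → ℤ) (t : ℝ) : L2 c l →ₗ.[ℂ] L2 c l :=
  (((t : ℂ) • siteOp hu c l j : L2 c l →L[ℂ] L2 c l) : L2 c l →ₗ[ℂ] L2 c l) +ᵥ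
    hamiltonian hu H₀ (Function.update q j 0)

/-! ### Conditional laws of the couplings -/

section Probability

variable {Ω : Type*} [MeasurableSpace Ω]

/-- The conditional law `μ_j` of `ω_j` given all `ω_k`, `k ≠ j` (a random measure on `ℝ`):
the regular conditional distribution, evaluated at the observed `(ω_k)_{k ≠ j}`. -/
def condLaw (P : Measure Ω) [IsFiniteMeasure P] (ω : (Fin d → ℤ) → Ω → ℝ) (j : Fin d → ℤ)
    (w : Ω) : Measure ℝ :=
  condDistrib (ω j) (fun w (k : {k // k ≠ j}) => ω k w) P fun k => ω k w

/-- `s(ε) = sup_j 𝔼 { sup_E μ_j([E, E + ε]) }`; a number in `[0, 1]` when `P` is a probability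
measure. -/
def sModulus (P : Measure Ω) [IsFiniteMeasure P] (ω : (Fin d → ℤ) → Ω → ℝ) (ε : ℝ) : ℝ :=
  (⨆ j, ∫⁻ w, ⨆ E : ℝ, condLaw P ω j w (Icc E (E + ε)) ∂P).toReal

end Probability

end RandomSchrodinger

end

/-! The heart is spectral averaging over one coupling with the other couplings frozen: for a
self-adjoint `H`, a positive `U` with `‖U‖ ≤ 1` and any s-finite measure `μ` on the line, `∫ Im ⟨φ,
U (H + tU - E - iε)⁻¹ U φ⟩ dμ(t)` is at most `2π/ε · sup_a μ [a, a + ε] · ‖φ‖²`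
(`lintegral_resolvent_le`).

Write `U = B²` and `K(t) = B (H + tU - z)⁻¹ B` with `z = E + iε`. The second resolvent identity
gives `K(t) + t K(t) K(0) = K(0)`, and `Im ⟨v, K(0) v⟩ ≥ ε ‖K(0) v‖²` says exactly that `C = 1 + 2iε
K(0)` is a contraction. Hence `K(t)` is a Möbius transform of `C` whose dependence on `t` is
explicit.

For a strict contraction, an operator version of the Poisson formula (`circleAverage_mobius`) writes
`⟨ψ, K(t) ψ⟩` as an average over the unit circle of the scalars `(t - x₀(w) - iε)⁻¹`, `x₀(w)` real,
against a nonnegative density of total mass `‖ψ‖²` that does not depend on `t`. The case `‖C‖ ≤ 1`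
follows by scaling and Fatou. Only scalar Poisson kernels of width `ε` then remain to be integrated
against `μ`, and each costs at most `2π/ε` times the concentration of `μ` at scale `ε`
(`lintegral_poisson_le`).

With `μ = μ_j`, integrating over an energy interval of length `ε` and taking the expectation gives
the first bound. For the second, the spectral projection of an interval centred at `E₀` of
half-width `κ = ε/2` is dominated by `(κ² + ε²)/ε = 5ε/4` times the imaginary part of the resolvent
at `E₀ + iε` (`IsSpectralFamily.re_inner_apply_le`). Disintegration along the conditional law and
averaging at the single energy `E₀` yield the constant `5/4 · 2π = 5π/2 < 8`. -/

noncomputable section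

namespace RandomSchrodinger

/-! ### Resolvents of self-adjoint operators and bounded perturbations. -/

section SelfAdjoint

variable {𝓗 : Type*} [NormedAddCommGroup 𝓗] [InnerProductSpace ℂ 𝓗]
variable {H : 𝓗 →ₗ.[ℂ] 𝓗} {z : ℂ} {R R' : 𝓗 →L[ℂ] 𝓗}

theorem IsResolventAt.unique (h : IsResolventAt H z R) (h' : IsResolventAt H z R') : R = R' := by
  ext v
  have := h'.left_inv ⟨R v, h.mem_domain v⟩
  rw [h.right_inv] at this
  exact this.symm

theorem IsResolventAt.resolvent_eq (h : IsResolventAt H z R) : resolvent H z = R := by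
  have hex : ∃ R, IsResolventAt H z R := ⟨R, h⟩
  rw [resolvent, dif_pos hex]
  exact hex.choose_spec.unique h

/-- The second resolvent identity for two bounded perturbations of the same operator. -/
theorem resolvent_sub_resolvent {B B' : 𝓗 →L[ℂ] 𝓗} {z' : ℂ}
    (h : IsResolventAt ((B : 𝓗 →ₗ[ℂ] 𝓗) +ᵥ H) z R)
    (h' : IsResolventAt ((B' : 𝓗 →ₗ[ℂ] 𝓗) +ᵥ H) z' R') :
    R - R' = R ∘L ((B' - B + (z - z') • 1) ∘L R') := by
  ext v
  have h1 := h.left_inv ⟨R' v, h'.mem_domain v⟩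
  have h2 := h'.right_inv v
  have hd : R' v ∈ H.domain := h'.mem_domain v
  change R (B (R' v) + H ⟨R' v, hd⟩ - z • R' v) = R' v at h1
  change B' (R' v) + H ⟨R' v, hd⟩ - z' • R' v = v at h2
  have h3 : (B' - B + (z - z') • (1 : 𝓗 →L[ℂ] 𝓗)) (R' v) =
      v - (B (R' v) + H ⟨R' v, hd⟩ - z • R' v) := by
    have h4 : H ⟨R' v, hd⟩ = v - B' (R' v) + z' • R' v := by
      rw [eq_sub_of_add_eq' (sub_eq_iff_eq_add.mp h2)]; abel
    rw [h4]
    simp only [add_apply, sub_apply, smul_apply, one_apply_eq_self, sub_smul]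
    abel
  change R v - R' v = R ((B' - B + (z - z') • (1 : 𝓗 →L[ℂ] 𝓗)) (R' v))
  rw [h3, map_sub, h1]

variable [CompleteSpace 𝓗]

theorem inner_apply_symm (hH : IsSelfAdjoint H) (x y : H.domain) :
    inner ℂ (H x) (y : 𝓗) = inner ℂ (x : 𝓗) (H y) := by
  have h := LinearPMap.adjoint_isFormalAdjoint (T := H) hH.dense_domain
  rw [LinearPMap.isSelfAdjoint_def.mp hH] at h
  exact h x y

theorem inner_apply_self_im (hH : IsSelfAdjoint H) (x : H.domain) :
    (inner ℂ (x : 𝓗) (H x)).im = 0 := by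
  have h := inner_apply_symm hH x x
  rw [← inner_conj_symm] at h
  exact Complex.conj_eq_iff_im.mp h

theorem inner_sub_smul_im (hH : IsSelfAdjoint H) (x : H.domain) (z : ℂ) :
    (inner ℂ (x : 𝓗) (H x - z • (x : 𝓗))).im = -z.im * ‖(x : 𝓗)‖ ^ 2 := by
  have hn : inner ℂ (x : 𝓗) (x : 𝓗) = ((‖(x : 𝓗)‖ ^ 2 : ℝ) : ℂ) := by
    exact_mod_cast inner_self_eq_norm_sq_to_K (𝕜 := ℂ) (x : 𝓗)
  rw [inner_sub_right, inner_smul_right, hn, Complex.sub_im, inner_apply_self_im hH,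
    Complex.im_mul_ofReal]
  ring

/-- Cauchy–Schwarz applied to `Im ⟨x, (H - z) x⟩ = -Im z ‖x‖²`. -/
theorem norm_le_norm_sub_smul (hH : IsSelfAdjoint H) (x : H.domain) (z : ℂ) :
    |z.im| * ‖(x : 𝓗)‖ ≤ ‖H x - z • (x : 𝓗)‖ := by
  rcases (norm_nonneg (x : 𝓗)).eq_or_lt with h0 | h0
  · rw [← h0]; simp
  have h1 : |z.im| * ‖(x : 𝓗)‖ ^ 2 ≤ ‖(x : 𝓗)‖ * ‖H x - z • (x : 𝓗)‖ := by
    have := (Complex.abs_im_le_norm (inner ℂ (x : 𝓗) (H x - z • (x : 𝓗)))).trans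
      (norm_inner_le_norm _ _)
    rwa [inner_sub_smul_im hH, abs_mul, abs_neg, abs_of_nonneg (sq_nonneg ‖(x : 𝓗)‖)] at this
  nlinarith

/-- `H - z`, viewed as a bounded operator on the graph of `H` (complete since `H` is closed), is
bounded below, so it is injective with closed range. A vector orthogonal to the range would be an
eigenvector of `H* = H` with eigenvalue `conj z`, which the lower bound forbids. -/
theorem exists_isResolventAt (hH : IsSelfAdjoint H) (hz : z.im ≠ 0) :
    ∃ R, IsResolventAt H z R := by
  have hzpos : 0 < |z.im| := abs_pos.mpr hz
  have : CompleteSpace H.graph := hH.isClosed.completeSpace_coe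
  let T : H.graph →L[ℂ] 𝓗 :=
    (ContinuousLinearMap.snd ℂ 𝓗 𝓗 - z • ContinuousLinearMap.fst ℂ 𝓗 𝓗) ∘L H.graph.subtypeL
  have hTapp : ∀ p : H.graph, T p = p.1.2 - z • p.1.1 := fun p => rfl
  have hgr : ∀ p : H.graph, ∃ x : H.domain, (x : 𝓗) = p.1.1 ∧ H x = p.1.2 := fun p =>
    (LinearPMap.mem_graph_iff H).mp p.2
  have hfst : ∀ p : H.graph, ‖p.1.1‖ ≤ |z.im|⁻¹ * ‖T p‖ := by
    intro p
    obtain ⟨x, hx1, hx2⟩ := hgr p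
    have := norm_le_norm_sub_smul hH x z
    rw [hx1, hx2, ← hTapp] at this
    rwa [inv_mul_eq_div, le_div_iff₀ hzpos, mul_comm]
  have hbound : ∀ p : H.graph, ‖p‖ ≤ (1 + (1 + ‖z‖) * |z.im|⁻¹) * ‖T p‖ := by
    intro p
    have h1 := hfst p
    have h2 : ‖p.1.2‖ ≤ ‖T p‖ + ‖z‖ * ‖p.1.1‖ := by
      have : p.1.2 = T p + z • p.1.1 := by rw [hTapp]; abel
      rw [this]
      exact (norm_add_le _ _).trans (by rw [norm_smul])
    have h3 : ‖z‖ * ‖p.1.1‖ ≤ ‖z‖ * (|z.im|⁻¹ * ‖T p‖) := by gcongr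
    have h4 : 0 ≤ |z.im|⁻¹ * ‖T p‖ := by positivity
    have h5 : 0 ≤ ‖z‖ * (|z.im|⁻¹ * ‖T p‖) := by positivity
    have h6 := norm_nonneg (T p)
    change max ‖p.1.1‖ ‖p.1.2‖ ≤ _
    refine max_le ?_ ?_ <;> nlinarith
  have hanti : AntilipschitzWith (Real.toNNReal (1 + (1 + ‖z‖) * |z.im|⁻¹)) T :=
    AddMonoidHomClass.antilipschitz_of_bound T fun p => by
      rw [Real.coe_toNNReal _ (by positivity)]; exact hbound p
  have hker : T.ker = ⊥ := LinearMap.ker_eq_bot.mpr hanti.injective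
  have hclosed : IsClosed (T.range : Set 𝓗) := by
    rw [LinearMap.coe_range]
    exact hanti.isClosed_range T.uniformContinuous
  have hmem : ∀ x : H.domain, H x - z • (x : 𝓗) ∈ T.range := fun x =>
    ⟨⟨((x : 𝓗), H x), H.mem_graph x⟩, rfl⟩
  have hrange : T.range = ⊤ := by
    have : CompleteSpace T.range := hclosed.completeSpace_coe
    rw [← Submodule.orthogonal_eq_bot_iff, Submodule.eq_bot_iff]
    intro y hy
    have hadj : ∀ x : H.domain, inner ℂ (conj z • y) (x : 𝓗) = inner ℂ y (H x) := by
      intro x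
      have h0 := (Submodule.mem_orthogonal' _ _).mp hy _ (hmem x)
      rw [inner_sub_right, sub_eq_zero, inner_smul_right] at h0
      rw [h0, inner_smul_left, Complex.conj_conj]
    have hyd : y ∈ (LinearPMap.adjoint H).domain :=
      LinearPMap.mem_adjoint_domain_of_exists y ⟨_, hadj⟩
    have hval := LinearPMap.adjoint_apply_eq hH.dense_domain ⟨y, hyd⟩ hadj
    have hsa : LinearPMap.adjoint H = H := LinearPMap.isSelfAdjoint_def.mp hH
    have hyd' : y ∈ H.domain := hsa ▸ hyd
    have hval' : H ⟨y, hyd'⟩ = conj z • y := by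
      rw [← hval]
      exact (hsa.le.2 (x := ⟨y, hyd⟩) (y := ⟨y, hyd'⟩) rfl).symm
    have := norm_le_norm_sub_smul hH ⟨y, hyd'⟩ (conj z)
    rw [hval', sub_self, norm_zero, Complex.conj_im, abs_neg] at this
    exact norm_le_zero_iff.mp (nonpos_of_mul_nonpos_right this hzpos)
  let e := ContinuousLinearEquiv.ofBijective T hker hrange
  have heT : ∀ p, e p = T p := fun p => rfl
  refine ⟨(ContinuousLinearMap.fst ℂ 𝓗 𝓗 ∘L H.graph.subtypeL) ∘L (e.symm : 𝓗 →L[ℂ] H.graph),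
    ⟨fun v => ?_, fun v => ?_, fun x => ?_⟩⟩
  · exact LinearPMap.mem_domain_of_mem_graph (e.symm v).2
  · obtain ⟨x, hx1, hx2⟩ := hgr (e.symm v)
    have hx : x = ⟨(e.symm v).1.1, LinearPMap.mem_domain_of_mem_graph (e.symm v).2⟩ :=
      Subtype.ext hx1
    have hv : T (e.symm v) = v := by rw [← heT, e.apply_symm_apply]
    rw [hTapp, ← hx2, hx] at hv
    exact hv
  · have : e ⟨((x : 𝓗), H x), H.mem_graph x⟩ = H x - z • (x : 𝓗) := rfl
    change (e.symm (H x - z • (x : 𝓗))).1.1 = _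
    rw [← this, e.symm_apply_apply]

theorem isResolventAt_resolvent (hH : IsSelfAdjoint H) (hz : z.im ≠ 0) :
    IsResolventAt H z (resolvent H z) := by
  obtain ⟨R, hR⟩ := exists_isResolventAt hH hz
  rwa [hR.resolvent_eq]

theorem IsResolventAt.inner_im (hH : IsSelfAdjoint H) (h : IsResolventAt H z R) (v : 𝓗) :
    (inner ℂ v (R v)).im = z.im * ‖R v‖ ^ 2 := by
  have h1 := inner_sub_smul_im hH ⟨R v, h.mem_domain v⟩ z
  rw [h.right_inv] at h1
  have h2 : (inner ℂ v (R v)).im = -(inner ℂ (R v) v).im := by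
    rw [← inner_conj_symm, Complex.conj_im]
  rw [h2, h1]
  ring

theorem IsResolventAt.norm_apply_le (hH : IsSelfAdjoint H) (h : IsResolventAt H z R) (v : 𝓗) :
    |z.im| * ‖R v‖ ≤ ‖v‖ := by
  have h1 := norm_le_norm_sub_smul hH ⟨R v, h.mem_domain v⟩ z
  rwa [h.right_inv] at h1

theorem IsResolventAt.norm_le (hH : IsSelfAdjoint H) (hz : z.im ≠ 0) (h : IsResolventAt H z R) :
    ‖R‖ ≤ |z.im|⁻¹ := by
  refine ContinuousLinearMap.opNorm_le_bound _ (by positivity) fun v => ?_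
  have := h.norm_apply_le hH v
  rwa [inv_mul_eq_div, le_div_iff₀ (abs_pos.mpr hz), mul_comm]

/-- The sum is symmetric, and adding the bounded functional `⟨y, B ·⟩` does not affect the
continuity that defines the domain of the adjoint. -/
theorem isSelfAdjoint_vadd (hH : IsSelfAdjoint H) {B : 𝓗 →L[ℂ] 𝓗} (hB : IsSelfAdjoint B) :
    IsSelfAdjoint ((B : 𝓗 →ₗ[ℂ] 𝓗) +ᵥ H) := by
  have hdense : Dense (((B : 𝓗 →ₗ[ℂ] 𝓗) +ᵥ H).domain : Set 𝓗) := hH.dense_domain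
  have hBs : ∀ x y : 𝓗, inner ℂ (B x) y = inner ℂ x (B y) := fun x y =>
    hB.isSymmetric x y
  have hle : ((B : 𝓗 →ₗ[ℂ] 𝓗) +ᵥ H) ≤ LinearPMap.adjoint ((B : 𝓗 →ₗ[ℂ] 𝓗) +ᵥ H) := by
    refine LinearPMap.IsFormalAdjoint.le_adjoint hdense fun x y => ?_
    change inner ℂ (B x + H x) (y : 𝓗) = inner ℂ (x : 𝓗) (B y + H y)
    rw [inner_add_left, inner_add_right, hBs, inner_apply_symm hH]
  refine (LinearPMap.isSelfAdjoint_def).mpr (LinearPMap.eq_of_le_of_domain_eq hle ?_).symm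
  refine le_antisymm hle.1 fun y hy => ?_
  rw [LinearPMap.mem_adjoint_domain_iff] at hy
  change y ∈ H.domain
  rw [← LinearPMap.isSelfAdjoint_def.mp hH, LinearPMap.mem_adjoint_domain_iff]
  have hc : Continuous fun x : H.domain => inner ℂ y (B x + H x) - inner ℂ y (B x) :=
    Continuous.sub hy (by fun_prop)
  refine hc.congr fun x => ?_
  change _ = inner ℂ y (H x)
  rw [inner_add_right]; ring

theorem norm_resolvent_sub_le (hH : IsSelfAdjoint H) {B B' : 𝓗 →L[ℂ] 𝓗} (hB : IsSelfAdjoint B)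
    (hB' : IsSelfAdjoint B') {z' : ℂ} (hz : z.im ≠ 0) (hz' : z'.im ≠ 0) :
    ‖resolvent ((B : 𝓗 →ₗ[ℂ] 𝓗) +ᵥ H) z - resolvent ((B' : 𝓗 →ₗ[ℂ] 𝓗) +ᵥ H) z'‖ ≤
      |z.im|⁻¹ * ((‖B' - B‖ + ‖z - z'‖) * |z'.im|⁻¹) := by
  have hs := isSelfAdjoint_vadd hH hB
  have hs' := isSelfAdjoint_vadd hH hB'
  have h := isResolventAt_resolvent hs hz
  have h' := isResolventAt_resolvent hs' hz'
  rw [resolvent_sub_resolvent h h']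
  refine (ContinuousLinearMap.opNorm_comp_le _ _).trans ?_
  refine mul_le_mul (h.norm_le hs hz) ?_ (norm_nonneg _) (by positivity)
  refine (ContinuousLinearMap.opNorm_comp_le _ _).trans ?_
  refine mul_le_mul ?_ (h'.norm_le hs' hz') (norm_nonneg _) (by positivity)
  refine (norm_add_le _ _).trans (add_le_add le_rfl ?_)
  rw [norm_smul]
  exact mul_le_of_le_one_right (norm_nonneg _) ContinuousLinearMap.norm_id_le

/-- Norm-continuity of the resolvent in the bounded part of the operator and the energy. -/
theorem continuous_resolvent (hH : IsSelfAdjoint H) {X : Type*} [TopologicalSpace X]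
    {B : X → 𝓗 →L[ℂ] 𝓗} (hB : ∀ x, IsSelfAdjoint (B x)) (hBc : Continuous B)
    {z : X → ℂ} (hz : ∀ x, (z x).im ≠ 0) (hzc : Continuous z) :
    Continuous fun x => resolvent ((B x : 𝓗 →ₗ[ℂ] 𝓗) +ᵥ H) (z x) := by
  rw [continuous_iff_continuousAt]
  intro x₀
  rw [ContinuousAt, tendsto_iff_norm_sub_tendsto_zero]
  refine squeeze_zero (fun _ => norm_nonneg _)
    (fun x => norm_resolvent_sub_le hH (hB x) (hB x₀) (hz x) (hz x₀)) ?_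
  have hc : ContinuousAt (fun x => |(z x).im|⁻¹ *
      ((‖B x₀ - B x‖ + ‖z x - z x₀‖) * |(z x₀).im|⁻¹)) x₀ := by
    refine ContinuousAt.mul (ContinuousAt.inv₀ ?_ (abs_ne_zero.mpr (hz x₀))) ?_
    · exact (continuous_abs.comp (Complex.continuous_im.comp hzc)).continuousAt
    · exact Continuous.continuousAt (by fun_prop)
  simpa [ContinuousAt] using hc

end SelfAdjoint

/-! ### Spectral projections dominated by the imaginary part of the resolvent. -/

section SpectralFamily

variable {𝓗 : Type*} [NormedAddCommGroup 𝓗] [InnerProductSpace ℂ 𝓗] [CompleteSpace 𝓗]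
variable {H : 𝓗 →ₗ.[ℂ] 𝓗} {E : Set ℝ → 𝓗 →L[ℂ] 𝓗} {S T Δ : Set ℝ}

namespace IsSpectralFamily

theorem apply_apply (hE : IsSpectralFamily H E) (hS : MeasurableSet S) (hT : MeasurableSet T)
    (a : 𝓗) : E S (E T a) = E (S ∩ T) a := by
  rw [hE.inter S T hS hT]; rfl

theorem inner_apply_left (hE : IsSpectralFamily H E) (hS : MeasurableSet S) (a b : 𝓗) :
    inner ℂ (E S a) b = inner ℂ a (E S b) :=
  (hE.isStarProjection S hS).isSelfAdjoint.isSymmetric a b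

theorem re_inner_apply_self (hE : IsSpectralFamily H E) (hS : MeasurableSet S) (a : 𝓗) :
    (inner ℂ a (E S a)).re = ‖E S a‖ ^ 2 := by
  have h : E S a = E S (E S a) := by rw [hE.apply_apply hS hS, inter_self]
  rw [h, ← hE.inner_apply_left hS, ← h]
  exact (norm_sq_eq_re_inner (𝕜 := ℂ) (E S a)).symm

/-- The scalar spectral measure of a vector. -/
def measure (hE : IsSpectralFamily H E) (ψ : 𝓗) : Measure ℝ := (hE.scalar ψ).choose

theorem measure_apply (hE : IsSpectralFamily H E) (hS : MeasurableSet S) (ψ : 𝓗) :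
    hE.measure ψ S = ENNReal.ofReal (‖E S ψ‖ ^ 2) := by
  rw [← hE.re_inner_apply_self hS]
  exact (hE.scalar ψ).choose_spec.1 S hS

theorem mem_domain_iff (hE : IsSpectralFamily H E) (ψ : 𝓗) :
    ψ ∈ H.domain ↔ ∫⁻ x, ENNReal.ofReal (x ^ 2) ∂hE.measure ψ < ∞ :=
  (hE.scalar ψ).choose_spec.2.1

theorem inner_apply (hE : IsSpectralFamily H E) (ψ : H.domain) :
    inner ℂ (ψ : 𝓗) (H ψ) = ((∫ x, x ∂hE.measure (ψ : 𝓗) : ℝ) : ℂ) :=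
  (hE.scalar ψ).choose_spec.2.2 ψ.2

theorem measure_univ (hE : IsSpectralFamily H E) (ψ : 𝓗) :
    hE.measure ψ Set.univ = ENNReal.ofReal (‖ψ‖ ^ 2) := by
  rw [hE.measure_apply MeasurableSet.univ, hE.univ]; rfl

instance (hE : IsSpectralFamily H E) (ψ : 𝓗) : IsFiniteMeasure (hE.measure ψ) :=
  ⟨by rw [hE.measure_univ]; exact ENNReal.ofReal_lt_top⟩

theorem empty (hE : IsSpectralFamily H E) : E ∅ = 0 := by
  ext ψ
  have h := hE.measure_apply MeasurableSet.empty ψ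
  rw [measure_empty, eq_comm, ENNReal.ofReal_eq_zero] at h
  simpa using sq_eq_zero_iff.mp (le_antisymm h (sq_nonneg _))

theorem inner_eq_zero (hE : IsSpectralFamily H E) (hS : MeasurableSet S) (hT : MeasurableSet T)
    (hST : S ∩ T = ∅) (a b : 𝓗) : inner ℂ (E S a) (E T b) = 0 := by
  rw [hE.inner_apply_left hS, hE.apply_apply hS hT, hST, hE.empty]
  simp

/-- Additivity of the projections is not an axiom of `IsSpectralFamily`; it comes from additivity of
the scalar measures. `E S a` and `E Sᶜ a` are orthogonal and their squared norms add up to `‖a‖²`,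
so nothing of `a` is left over. -/
theorem apply_add_compl (hE : IsSpectralFamily H E) (hS : MeasurableSet S) (a : 𝓗) :
    E S a + E Sᶜ a = a := by
  have h0 : inner ℂ (a - E S a - E Sᶜ a) (a - E S a - E Sᶜ a) = 0 := by
    have hm : (hE.measure a) Set.univ = hE.measure a S + hE.measure a Sᶜ :=
      (measure_add_measure_compl hS).symm
    rw [hE.measure_univ, hE.measure_apply hS, hE.measure_apply hS.compl,
      ← ENNReal.ofReal_add (by positivity) (by positivity),
      ENNReal.ofReal_eq_ofReal_iff (by positivity) (by positivity)] at hm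
    have h1 : inner ℂ (E S a) (E Sᶜ a) = 0 :=
      hE.inner_eq_zero hS hS.compl (inter_compl_self S) a a
    have h2 : ‖E S a + E Sᶜ a‖ ^ 2 = ‖E S a‖ ^ 2 + ‖E Sᶜ a‖ ^ 2 := by
      have := norm_add_sq_eq_norm_sq_add_norm_sq_of_inner_eq_zero _ _ h1
      simpa [sq] using this
    have h3 : ‖a - (E S a + E Sᶜ a)‖ ^ 2 = 0 := by
      rw [norm_sub_sq (𝕜 := ℂ), h2, inner_add_right, map_add]
      have e1 := hE.re_inner_apply_self hS a
      have e2 := hE.re_inner_apply_self hS.compl a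
      change (RCLike.re (inner ℂ a (E S a)) : ℝ) = _ at e1
      change (RCLike.re (inner ℂ a (E Sᶜ a)) : ℝ) = _ at e2
      rw [e1, e2, hm]; ring
    rw [sub_sub, norm_eq_zero.mp (sq_eq_zero_iff.mp h3), inner_zero_left]
  have := inner_self_eq_zero.mp h0
  rw [sub_sub, sub_eq_zero] at this
  exact this.symm

theorem measure_add (hE : IsSpectralFamily H E) (hΔ : MeasurableSet Δ) {v w : 𝓗}
    (hv : E Δ v = v) (hw : E Δᶜ w = w) :
    hE.measure (v + w) = hE.measure v + hE.measure w := by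
  ext S hS
  rw [Measure.add_apply, hE.measure_apply hS, hE.measure_apply hS, hE.measure_apply hS,
    ← ENNReal.ofReal_add (by positivity) (by positivity)]
  congr 1
  have h0 : inner ℂ (E S v) (E S w) = 0 := by
    rw [← hv, ← hw, hE.apply_apply hS hΔ, hE.apply_apply hS hΔ.compl]
    refine hE.inner_eq_zero (hS.inter hΔ) (hS.inter hΔ.compl) ?_ v w
    ext x; simp; tauto
  have := norm_add_sq_eq_norm_sq_add_norm_sq_of_inner_eq_zero _ _ h0
  rw [map_add]
  simpa [sq] using this

theorem ae_mem (hE : IsSpectralFamily H E) (hΔ : MeasurableSet Δ) {v : 𝓗} (hv : E Δ v = v) :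
    ∀ᵐ x ∂hE.measure v, x ∈ Δ := by
  rw [ae_iff]
  change hE.measure v Δᶜ = 0
  rw [hE.measure_apply hΔ.compl, ← hv, hE.apply_apply hΔ.compl hΔ, compl_inter_self, hE.empty]
  simp

theorem integrable_id (hE : IsSpectralFamily H E) (v : H.domain) :
    Integrable (fun x : ℝ => x) (hE.measure (v : 𝓗)) := by
  have h := (hE.mem_domain_iff (v : 𝓗)).mp v.2
  have h2 : Integrable (fun x : ℝ => x ^ 2) (hE.measure (v : 𝓗)) := by
    refine ⟨by fun_prop, ?_⟩
    rwa [hasFiniteIntegral_iff_ofReal (Filter.Eventually.of_forall fun x => sq_nonneg x)]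
  refine ((integrable_const (1 : ℝ)).add h2).mono' (by fun_prop)
    (Filter.Eventually.of_forall fun x => ?_)
  change |x| ≤ 1 + x ^ 2
  rw [abs_le]
  constructor <;> nlinarith [sq_nonneg (x - 1), sq_nonneg (x + 1)]

theorem apply_mem_domain (hE : IsSpectralFamily H E) (hΔ : MeasurableSet Δ) {E₀ κ : ℝ}
    (hsub : Δ ⊆ Icc (E₀ - κ) (E₀ + κ)) {v : 𝓗} (hv : E Δ v = v) : v ∈ H.domain := by
  rw [hE.mem_domain_iff]
  have hle : ∫⁻ x, ENNReal.ofReal (x ^ 2) ∂hE.measure v ≤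
      ∫⁻ _, ENNReal.ofReal ((|E₀| + κ) ^ 2) ∂hE.measure v := by
    refine lintegral_mono_ae ((hE.ae_mem hΔ hv).mono fun x hx => ENNReal.ofReal_le_ofReal ?_)
    have h1 := hsub hx
    have h2 := neg_abs_le E₀
    have h3 := le_abs_self E₀
    exact sq_le_sq' (by linarith [h1.1]) (by linarith [h1.2])
  refine hle.trans_lt ?_
  rw [lintegral_const]
  exact ENNReal.mul_lt_top ENNReal.ofReal_lt_top (measure_lt_top _ _)

theorem abs_form_le (hE : IsSpectralFamily H E) (hΔ : MeasurableSet Δ) {E₀ κ : ℝ}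
    (hsub : Δ ⊆ Icc (E₀ - κ) (E₀ + κ)) (v : H.domain) (hv : E Δ (v : 𝓗) = v) :
    |(inner ℂ (v : 𝓗) (H v - (E₀ : ℂ) • (v : 𝓗))).re| ≤ κ * ‖(v : 𝓗)‖ ^ 2 := by
  have hreal : (hE.measure (v : 𝓗)).real Set.univ = ‖(v : 𝓗)‖ ^ 2 := by
    rw [Measure.real, hE.measure_univ, ENNReal.toReal_ofReal (by positivity)]
  have h1 : (inner ℂ (v : 𝓗) (H v - (E₀ : ℂ) • (v : 𝓗))).re =
      ∫ x, (x - E₀) ∂hE.measure (v : 𝓗) := by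
    rw [integral_sub (hE.integrable_id v) (integrable_const _), integral_const, hreal,
      inner_sub_right, inner_smul_right, hE.inner_apply, Complex.sub_re, Complex.ofReal_re,
      Complex.re_ofReal_mul, smul_eq_mul, mul_comm E₀]
    congr 2
    exact (norm_sq_eq_re_inner (𝕜 := ℂ) (v : 𝓗)).symm
  rw [h1, ← hreal, ← Real.norm_eq_abs]
  refine norm_integral_le_of_norm_le_const ((hE.ae_mem hΔ hv).mono fun x hx => ?_)
  have := hsub hx
  rw [Real.norm_eq_abs, abs_le]
  constructor <;> linarith [this.1, this.2]

/-- The scalar measures of `v` and `w` add up to that of `v + w`, so the quadratic form of `H` is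
additive on the pair and the cross term must vanish. Replacing `w` by `I • w` handles the imaginary
part afterwards. -/
theorem re_inner_apply_eq_zero (hH : IsSelfAdjoint H) (hE : IsSpectralFamily H E)
    (hΔ : MeasurableSet Δ) (v w : H.domain) (hv : E Δ (v : 𝓗) = v) (hw : E Δᶜ (w : 𝓗) = w) :
    (inner ℂ (w : 𝓗) (H v)).re = 0 := by
  have h := hE.inner_apply (v + w)
  rw [Submodule.coe_add, hE.measure_add hΔ hv hw,
    integral_add_measure (hE.integrable_id v) (hE.integrable_id w), Complex.ofReal_add,
    ← hE.inner_apply, ← hE.inner_apply, LinearPMap.map_add, inner_add_left, inner_add_right,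
    inner_add_right, ← inner_apply_symm hH v w, ← inner_conj_symm (H v) (w : 𝓗)] at h
  have h2 := congrArg Complex.re h
  simp only [Complex.add_re, Complex.conj_re] at h2
  linarith

theorem inner_apply_eq_zero (hH : IsSelfAdjoint H) (hE : IsSpectralFamily H E)
    (hΔ : MeasurableSet Δ) (v w : H.domain) (hv : E Δ (v : 𝓗) = v) (hw : E Δᶜ (w : 𝓗) = w) :
    inner ℂ (w : 𝓗) (H v) = 0 := by
  refine Complex.ext (hE.re_inner_apply_eq_zero hH hΔ v w hv hw) ?_
  have h := hE.re_inner_apply_eq_zero hH hΔ v (Complex.I • w) hv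
    (by rw [Submodule.coe_smul, map_smul, hw])
  rw [Submodule.coe_smul, inner_smul_left] at h
  simpa using h

/-- The spectral subspace of a bounded set is invariant under `H`: the component of `(H - E₀) v` in
the complementary subspace is orthogonal to the dense domain of `H`. -/
theorem apply_sub_smul (hH : IsSelfAdjoint H) (hE : IsSpectralFamily H E)
    (hΔ : MeasurableSet Δ) {E₀ κ : ℝ} (hsub : Δ ⊆ Icc (E₀ - κ) (E₀ + κ))
    (v : H.domain) (hv : E Δ (v : 𝓗) = v) :
    E Δ (H v - (E₀ : ℂ) • (v : 𝓗)) = H v - (E₀ : ℂ) • (v : 𝓗) := by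
  set g := H v - (E₀ : ℂ) • (v : 𝓗)
  have hzero : E Δᶜ g = 0 := by
    refine hH.dense_domain.eq_zero_of_inner_right (𝕜 := ℂ) fun w' hw' => ?_
    obtain ⟨w, rfl⟩ : ∃ w : H.domain, (w : 𝓗) = w' := ⟨⟨w', hw'⟩, rfl⟩
    have hPw : E Δ (w : 𝓗) ∈ H.domain :=
      hE.apply_mem_domain hΔ hsub (by rw [hE.apply_apply hΔ hΔ, inter_self])
    have hQw : E Δᶜ (w : 𝓗) ∈ H.domain := by
      have : E Δᶜ (w : 𝓗) = w - E Δ (w : 𝓗) :=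
        eq_sub_of_add_eq' (hE.apply_add_compl hΔ (w : 𝓗))
      rw [this]
      exact H.domain.sub_mem w.2 hPw
    rw [← hE.inner_apply_left hΔ.compl, inner_sub_right, inner_smul_right,
      hE.inner_apply_eq_zero hH hΔ v ⟨_, hQw⟩ hv
        (by rw [hE.apply_apply hΔ.compl hΔ.compl, inter_self]), ← hv,
      hE.inner_eq_zero hΔ.compl hΔ (compl_inter_self Δ)]
    simp
  have := hE.apply_add_compl hΔ g
  rwa [hzero, add_zero] at this

/-- `IsSpectralFamily` gives the first moment, hence a bound on the quadratic form of `H - E₀`; for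
a symmetric operator on an invariant subspace this is already a norm bound. With `g = (H - E₀) v`,
polarize between `κ v + g` and `κ v - g`. -/
theorem norm_sub_smul_le (hH : IsSelfAdjoint H) (hE : IsSpectralFamily H E)
    (hΔ : MeasurableSet Δ) {E₀ κ : ℝ} (hκ : 0 < κ) (hsub : Δ ⊆ Icc (E₀ - κ) (E₀ + κ))
    (v : H.domain) (hv : E Δ (v : 𝓗) = v) :
    ‖H v - (E₀ : ℂ) • (v : 𝓗)‖ ^ 2 ≤ κ ^ 2 * ‖(v : 𝓗)‖ ^ 2 := by
  have hg := hE.apply_sub_smul hH hΔ hsub v hv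
  have hgd := hE.apply_mem_domain hΔ hsub hg
  obtain ⟨g, hgv⟩ : ∃ g : H.domain, (g : 𝓗) = H v - (E₀ : ℂ) • (v : 𝓗) := ⟨⟨_, hgd⟩, rfl⟩
  rw [← hgv] at hg ⊢
  have hq : ∀ x y : H.domain, inner ℂ (x : 𝓗) (H y - (E₀ : ℂ) • (y : 𝓗)) =
      conj (inner ℂ (y : 𝓗) (H x - (E₀ : ℂ) • (x : 𝓗))) := fun x y => by
    rw [inner_conj_symm, inner_sub_right, inner_sub_left, inner_apply_symm hH, inner_smul_right,
      inner_smul_left, Complex.conj_ofReal]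
  have hvκ : E Δ ((κ : ℂ) • (v : 𝓗)) = (κ : ℂ) • (v : 𝓗) := by rw [map_smul, hv]
  have h1 := hE.abs_form_le hΔ hsub ((κ : ℂ) • v + g) (by
    rw [Submodule.coe_add, Submodule.coe_smul, map_add, hvκ, hg])
  have h2 := hE.abs_form_le hΔ hsub ((κ : ℂ) • v - g) (by
    rw [Submodule.coe_sub, Submodule.coe_smul, map_sub, hvκ, hg])
  have h3 := parallelogram_law_with_norm ℂ ((κ : ℂ) • (v : 𝓗)) (g : 𝓗)
  have hnorm : ‖(κ : ℂ) • (v : 𝓗)‖ = κ * ‖(v : 𝓗)‖ := by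
    rw [norm_smul, Complex.norm_real, Real.norm_of_nonneg hκ.le]
  rw [hnorm] at h3
  have hcross : (inner ℂ (g : 𝓗) (H v - (E₀ : ℂ) • (v : 𝓗))).re = ‖(g : 𝓗)‖ ^ 2 := by
    rw [← hgv]
    exact (norm_sq_eq_re_inner (𝕜 := ℂ) (g : 𝓗)).symm
  have hcross' : (inner ℂ (v : 𝓗) (H g - (E₀ : ℂ) • (g : 𝓗))).re = ‖(g : 𝓗)‖ ^ 2 := by
    rw [hq, Complex.conj_re, hcross]
  have e1 : (inner ℂ (((κ : ℂ) • v + g : H.domain) : 𝓗) (H ((κ : ℂ) • v + g) -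
      (E₀ : ℂ) • (((κ : ℂ) • v + g : H.domain) : 𝓗))).re =
      κ ^ 2 * (inner ℂ (v : 𝓗) (H v - (E₀ : ℂ) • (v : 𝓗))).re + 2 * κ * ‖(g : 𝓗)‖ ^ 2 +
      (inner ℂ (g : 𝓗) (H g - (E₀ : ℂ) • (g : 𝓗))).re := by
    have : H ((κ : ℂ) • v + g) - (E₀ : ℂ) • (((κ : ℂ) • v + g : H.domain) : 𝓗) =
        (κ : ℂ) • (H v - (E₀ : ℂ) • (v : 𝓗)) + (H g - (E₀ : ℂ) • (g : 𝓗)) := by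
      rw [LinearPMap.map_add, LinearPMap.map_smul, Submodule.coe_add, Submodule.coe_smul]
      module
    generalize H v - (E₀ : ℂ) • (v : 𝓗) = a at this hcross ⊢
    generalize H g - (E₀ : ℂ) • (g : 𝓗) = b at this hcross' ⊢
    rw [this, Submodule.coe_add, Submodule.coe_smul, inner_add_left, inner_add_right,
      inner_add_right, inner_smul_left, inner_smul_left, inner_smul_right, inner_smul_right]
    simp only [Complex.add_re, Complex.conj_ofReal, Complex.re_ofReal_mul, hcross, hcross']
    ring
  have e2 : (inner ℂ (((κ : ℂ) • v - g : H.domain) : 𝓗) (H ((κ : ℂ) • v - g) -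
      (E₀ : ℂ) • (((κ : ℂ) • v - g : H.domain) : 𝓗))).re =
      κ ^ 2 * (inner ℂ (v : 𝓗) (H v - (E₀ : ℂ) • (v : 𝓗))).re - 2 * κ * ‖(g : 𝓗)‖ ^ 2 +
      (inner ℂ (g : 𝓗) (H g - (E₀ : ℂ) • (g : 𝓗))).re := by
    have : H ((κ : ℂ) • v - g) - (E₀ : ℂ) • (((κ : ℂ) • v - g : H.domain) : 𝓗) =
        (κ : ℂ) • (H v - (E₀ : ℂ) • (v : 𝓗)) - (H g - (E₀ : ℂ) • (g : 𝓗)) := by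
      rw [LinearPMap.map_sub, LinearPMap.map_smul, Submodule.coe_sub, Submodule.coe_smul]
      module
    generalize H v - (E₀ : ℂ) • (v : 𝓗) = a at this hcross ⊢
    generalize H g - (E₀ : ℂ) • (g : 𝓗) = b at this hcross' ⊢
    rw [this, Submodule.coe_sub, Submodule.coe_smul, inner_sub_left, inner_sub_right,
      inner_sub_right, inner_smul_left, inner_smul_left, inner_smul_right, inner_smul_right]
    simp only [Complex.sub_re, Complex.conj_ofReal, Complex.re_ofReal_mul, hcross, hcross']
    ring
  rw [e1] at h1
  rw [e2] at h2
  have h4 := (abs_le.mp h1).2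
  have h5 := (abs_le.mp h2).1
  rw [Submodule.coe_add, Submodule.coe_smul] at h4
  rw [Submodule.coe_sub, Submodule.coe_smul] at h5
  -- The forms at `κ v ± g` differ by `4κ ‖g‖²`; the form bound and the parallelogram law control
  -- the difference.
  have h6 : κ * (4 * ‖(g : 𝓗)‖ ^ 2) ≤ κ * (2 * (κ ^ 2 * ‖(v : 𝓗)‖ ^ 2 + ‖(g : 𝓗)‖ ^ 2)) := by
    have h7 : κ * (‖(κ : ℂ) • (v : 𝓗) + g‖ ^ 2 + ‖(κ : ℂ) • (v : 𝓗) - g‖ ^ 2) = _ :=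
      congrArg (κ * ·) h3
    linarith
  linarith [le_of_mul_le_mul_left h6 hκ]

/-- The spectral projection of a bounded interval is dominated by the imaginary part of the
resolvent. -/
theorem re_inner_apply_le (hH : IsSelfAdjoint H) (hE : IsSpectralFamily H E)
    (hΔ : MeasurableSet Δ) {E₀ κ ε : ℝ} (hκ : 0 < κ) (hε : 0 < ε)
    (hsub : Δ ⊆ Icc (E₀ - κ) (E₀ + κ)) {R : 𝓗 →L[ℂ] 𝓗}
    (hR : IsResolventAt H ((E₀ : ℂ) + Complex.I * (ε : ℂ)) R) (ψ : 𝓗) :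
    (inner ℂ ψ (E Δ ψ)).re ≤ (κ ^ 2 + ε ^ 2) / ε * (inner ℂ ψ (R ψ)).im := by
  set z : ℂ := (E₀ : ℂ) + Complex.I * (ε : ℂ) with hz
  have hzim : z.im = ε := by simp [hz]
  rw [hE.re_inner_apply_self hΔ, hR.inner_im hH, hzim]
  have hPP : E Δ (E Δ ψ) = E Δ ψ := by rw [hE.apply_apply hΔ hΔ, inter_self]
  obtain ⟨v, hv⟩ : ∃ v : H.domain, (v : 𝓗) = E Δ ψ := ⟨⟨_, hE.apply_mem_domain hΔ hsub hPP⟩, rfl⟩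
  obtain ⟨χ, hχ⟩ : ∃ χ : H.domain, (χ : 𝓗) = R ψ := ⟨⟨_, hR.mem_domain ψ⟩, rfl⟩
  have hχeq : H χ - z • (χ : 𝓗) = ψ := by
    have h := hR.right_inv ψ
    have h' : χ = ⟨R ψ, hR.mem_domain ψ⟩ := Subtype.ext hχ
    rw [h']; exact h
  have hPv : E Δ (v : 𝓗) = v := by rw [hv, hPP]
  have hg := hE.norm_sub_smul_le hH hΔ hκ hsub v hPv
  rw [← hv, ← hχ]
  -- With `v` the projection of `ψ`, `‖v‖² = ⟨v, ψ⟩`; insert `ψ = (H - z) χ` and move `H - z` to the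
  -- left. The resulting factor has `‖(H - conj z) v‖² ≤ (κ² + ε²) ‖v‖²`.
  have h1 : ‖(v : 𝓗)‖ ^ 2 = (inner ℂ (H v - conj z • (v : 𝓗)) (χ : 𝓗)).re := by
    rw [norm_sq_eq_re_inner (𝕜 := ℂ)]
    conv_lhs => rw [hv, hE.inner_apply_left hΔ, hPP, ← hE.inner_apply_left hΔ, ← hv]
    conv_lhs => rw [← hχeq]
    rw [inner_sub_right, inner_sub_left, inner_apply_symm hH, inner_smul_left, inner_smul_right,
      Complex.conj_conj]
    rfl
  have h2 : ‖(v : 𝓗)‖ ^ 2 ≤ ‖H v - conj z • (v : 𝓗)‖ * ‖(χ : 𝓗)‖ := by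
    rw [h1]
    exact (Complex.re_le_norm _).trans (norm_inner_le_norm _ _)
  have h3 : ‖H v - conj z • (v : 𝓗)‖ ^ 2 =
      ‖H v - (E₀ : ℂ) • (v : 𝓗)‖ ^ 2 + ε ^ 2 * ‖(v : 𝓗)‖ ^ 2 := by
    have e : H v - conj z • (v : 𝓗) =
        (H v - (E₀ : ℂ) • (v : 𝓗)) + (Complex.I * (ε : ℂ)) • (v : 𝓗) := by
      have : conj z = (E₀ : ℂ) - Complex.I * ε := by simp [hz, sub_eq_add_neg]
      rw [this]; module
    have him : (inner ℂ (H v - (E₀ : ℂ) • (v : 𝓗)) (v : 𝓗)).im = 0 := by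
      have := inner_sub_smul_im hH v (E₀ : ℂ)
      rw [Complex.ofReal_im, neg_zero, zero_mul] at this
      rw [← inner_conj_symm, Complex.conj_im, this, neg_zero]
    rw [e, norm_add_sq (𝕜 := ℂ), norm_smul, inner_smul_right]
    have hre : RCLike.re (Complex.I * (ε : ℂ) * inner ℂ (H v - (E₀ : ℂ) • (v : 𝓗)) (v : 𝓗)) =
        0 := by
      change (Complex.I * (ε : ℂ) * inner ℂ (H v - (E₀ : ℂ) • (v : 𝓗)) (v : 𝓗)).re = 0
      rw [mul_assoc, Complex.I_mul_re, Complex.im_ofReal_mul, him]; simp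
    rw [hre]
    simp [mul_pow, abs_of_pos hε]
  have h4 : ‖(v : 𝓗)‖ ^ 2 * ‖(v : 𝓗)‖ ^ 2 ≤
      ((κ ^ 2 + ε ^ 2) * ‖(χ : 𝓗)‖ ^ 2) * ‖(v : 𝓗)‖ ^ 2 := by
    calc ‖(v : 𝓗)‖ ^ 2 * ‖(v : 𝓗)‖ ^ 2
        ≤ (‖H v - conj z • (v : 𝓗)‖ * ‖(χ : 𝓗)‖) * (‖H v - conj z • (v : 𝓗)‖ * ‖(χ : 𝓗)‖) := by
          gcongr
      _ = ‖H v - conj z • (v : 𝓗)‖ ^ 2 * ‖(χ : 𝓗)‖ ^ 2 := by ring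
      _ ≤ ((κ ^ 2 + ε ^ 2) * ‖(v : 𝓗)‖ ^ 2) * ‖(χ : 𝓗)‖ ^ 2 := by
          rw [h3]; gcongr; linarith
      _ = _ := by ring
  have h5 : (κ ^ 2 + ε ^ 2) / ε * (ε * ‖(χ : 𝓗)‖ ^ 2) = (κ ^ 2 + ε ^ 2) * ‖(χ : 𝓗)‖ ^ 2 := by
    field_simp
  rw [h5]
  rcases (sq_nonneg ‖(v : 𝓗)‖).eq_or_lt with h0 | h0
  · rw [← h0]; positivity
  · exact le_of_mul_le_mul_right h4 h0

end IsSpectralFamily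

end SpectralFamily

/-! ### Operator Poisson kernel of a strict contraction. -/

section Contraction

variable {𝓗 : Type*} [NormedAddCommGroup 𝓗] [InnerProductSpace ℂ 𝓗]
variable {D : 𝓗 →L[ℂ] 𝓗} {w z : ℂ}

/-- The operator `(1 - w D)⁻¹`. -/
def neumann (D : 𝓗 →L[ℂ] 𝓗) (w : ℂ) : 𝓗 →L[ℂ] 𝓗 := Ring.inverse (1 - w • D)

@[simp] theorem neumann_zero : neumann D 0 = 1 := by simp [neumann]

/-- Twice the real part of `⟨ψ, (1 - w D)⁻¹ ψ⟩`, minus `‖ψ‖²`: the operator Poisson kernel. -/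
def opPoisson (D : 𝓗 →L[ℂ] 𝓗) (ψ : 𝓗) (w : ℂ) : ℝ :=
  2 * (inner ℂ ψ (neumann D w ψ)).re - ‖ψ‖ ^ 2

theorem ofReal_opPoisson (ψ : 𝓗) (w : ℂ) :
    (opPoisson D ψ w : ℂ) = inner ℂ ψ (neumann D w ψ) + conj (inner ℂ ψ (neumann D w ψ)) -
      ((‖ψ‖ ^ 2 : ℝ) : ℂ) := by
  rw [Complex.add_conj, opPoisson]
  push_cast
  ring

theorem inner_self_ofReal (ψ : 𝓗) : inner ℂ ψ ψ = ((‖ψ‖ ^ 2 : ℝ) : ℂ) := by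
  exact_mod_cast inner_self_eq_norm_sq_to_K (𝕜 := ℂ) ψ

theorem norm_mul_norm_lt_one (hD : ‖D‖ < 1) (hw : ‖w‖ ≤ 1) : ‖w‖ * ‖D‖ < 1 :=
  (mul_le_of_le_one_left (norm_nonneg _) hw).trans_lt hD

variable [CompleteSpace 𝓗]

theorem isUnit_one_sub_smul (h : ‖w‖ * ‖D‖ < 1) : IsUnit (1 - w • D) :=
  isUnit_one_sub_of_norm_lt_one (by rwa [norm_smul])

theorem mul_neumann (h : ‖w‖ * ‖D‖ < 1) : (1 - w • D) * neumann D w = 1 :=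
  Ring.mul_inverse_cancel _ (isUnit_one_sub_smul h)

theorem neumann_mul (h : ‖w‖ * ‖D‖ < 1) : neumann D w * (1 - w • D) = 1 :=
  Ring.inverse_mul_cancel _ (isUnit_one_sub_smul h)

theorem neumann_commute (h : ‖w‖ * ‖D‖ < 1) : Commute D (neumann D w) := by
  have hc : D * (1 - w • D) = (1 - w • D) * D := by
    rw [mul_sub, sub_mul, mul_one, one_mul, mul_smul_comm, smul_mul_assoc]
  calc D * neumann D w = (neumann D w * (1 - w • D)) * D * neumann D w := by
        rw [neumann_mul h, one_mul]
    _ = neumann D w * D * ((1 - w • D) * neumann D w) := by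
        rw [mul_assoc (neumann D w), ← hc]; simp only [mul_assoc]
    _ = neumann D w * D := by rw [mul_neumann h, mul_one]

theorem differentiableAt_neumann (h : ‖w‖ * ‖D‖ < 1) :
    DifferentiableAt ℂ (neumann D) w := by
  obtain ⟨x, hx⟩ := isUnit_one_sub_smul h
  have h1 : DifferentiableAt ℂ Ring.inverse (1 - w • D) := hx ▸ differentiableAt_inverse x.isUnit
  exact h1.comp w (f := fun w : ℂ => 1 - w • D) (by fun_prop)

/-- With `χ = (1 - w D)⁻¹ ψ` the kernel equals `‖χ‖² - ‖w D χ‖²`. -/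
theorem opPoisson_nonneg (hD : ‖D‖ < 1) (ψ : 𝓗) (hw : ‖w‖ ≤ 1) : 0 ≤ opPoisson D ψ w := by
  have h : ‖w‖ * ‖D‖ < 1 := (mul_le_of_le_one_left (norm_nonneg _) hw).trans_lt hD
  set χ := neumann D w ψ with hχ
  have h1 : ψ = χ - w • D χ := by
    have := congrArg (fun T : 𝓗 →L[ℂ] 𝓗 => T ψ) (mul_neumann h)
    simpa using this.symm
  have h2 : ‖w • D χ‖ ≤ ‖χ‖ := by
    rw [norm_smul]
    have h3 := D.le_opNorm χ
    have h4 := norm_nonneg χ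
    calc ‖w‖ * ‖D χ‖ ≤ ‖w‖ * (‖D‖ * ‖χ‖) := by gcongr
      _ = (‖w‖ * ‖D‖) * ‖χ‖ := by ring
      _ ≤ 1 * ‖χ‖ := by gcongr
      _ = ‖χ‖ := one_mul _
  have h3 : ‖ψ‖ ^ 2 = ‖χ‖ ^ 2 - 2 * (inner ℂ χ (w • D χ)).re + ‖w • D χ‖ ^ 2 := by
    rw [h1]; exact norm_sub_sq (𝕜 := ℂ) _ _
  have h4 : (inner ℂ ψ χ).re = ‖χ‖ ^ 2 - (inner ℂ χ (w • D χ)).re := by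
    rw [h1, inner_sub_left, Complex.sub_re, ← inner_conj_symm (w • D χ) χ, Complex.conj_re]
    congr 1
    exact (norm_sq_eq_re_inner (𝕜 := ℂ) χ).symm
  rw [opPoisson, ← hχ, h3, h4]
  nlinarith [norm_nonneg (w • D χ)]

theorem circleAverage_eq_center {f : ℂ → ℂ} (hf : ∀ w, ‖w‖ ≤ 1 → DifferentiableAt ℂ f w) :
    Real.circleAverage f 0 1 = f 0 := by
  refine DiffContOnCl.circleAverage (DifferentiableOn.diffContOnCl fun w hw => ?_)
  rw [abs_one, closure_ball _ one_ne_zero, mem_closedBall_zero_iff] at hw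
  exact (hf w hw).differentiableWithinAt

theorem circleAverage_conj_eq_center {f : ℂ → ℂ} (hf : ∀ w, ‖w‖ ≤ 1 → DifferentiableAt ℂ f w) :
    Real.circleAverage (fun w => conj (f w)) 0 1 = conj (f 0) := by
  have hi : CircleIntegrable f 0 1 := ContinuousOn.circleIntegrable zero_le_one fun w hw =>
    (hf w (mem_sphere_zero_iff_norm.mp hw).le).continuousAt.continuousWithinAt
  have := (Complex.conjCLE : ℂ →L[ℝ] ℂ).circleAverage_comp_comm hi
  rw [circleAverage_eq_center hf] at this
  exact this

theorem circleIntegrable_of_differentiableAt {f : ℂ → ℂ}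
    (hf : ∀ w, ‖w‖ ≤ 1 → DifferentiableAt ℂ f w) : CircleIntegrable f 0 1 :=
  ContinuousOn.circleIntegrable zero_le_one fun w hw =>
    (hf w (mem_sphere_zero_iff_norm.mp hw).le).continuousAt.continuousWithinAt

/-- Mean value property for harmonic functions in the form used below: split the integrand on the
circle into a holomorphic and an antiholomorphic part and evaluate both at the centre. -/
theorem circleAverage_add_conj {A B f : ℂ → ℂ} (hA : ∀ w, ‖w‖ ≤ 1 → DifferentiableAt ℂ A w)
    (hB : ∀ w, ‖w‖ ≤ 1 → DifferentiableAt ℂ B w)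
    (hf : ∀ w, ‖w‖ = 1 → f w = A w + conj (B w)) :
    Real.circleAverage f 0 1 = A 0 + conj (B 0) := by
  have hBc : CircleIntegrable (fun w => conj (B w)) 0 1 :=
    ContinuousOn.circleIntegrable zero_le_one fun w hw =>
      (Complex.continuous_conj.continuousAt.comp
        (hB w (mem_sphere_zero_iff_norm.mp hw).le).continuousAt).continuousWithinAt
  rw [← circleAverage_eq_center hA, ← circleAverage_conj_eq_center hB,
    ← Real.circleAverage_fun_add (circleIntegrable_of_differentiableAt hA) hBc]
  refine Real.circleAverage_congr_sphere fun w hw => ?_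
  rw [abs_one] at hw
  exact hf w (mem_sphere_zero_iff_norm.mp hw)

theorem differentiableAt_inner_neumann (hD : ‖D‖ < 1) (ψ χ : 𝓗) (hw : ‖w‖ ≤ 1) :
    DifferentiableAt ℂ (fun w => inner ℂ ψ (neumann D w χ)) w := by
  have h1 := differentiableAt_neumann (norm_mul_norm_lt_one hD hw)
  have h2 : DifferentiableAt ℂ (fun w => neumann D w χ) w := h1.clm_apply (by fun_prop)
  exact (innerSL ℂ ψ).differentiableAt.comp w h2

theorem circleAverage_opPoisson (hD : ‖D‖ < 1) (ψ : 𝓗) :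
    Real.circleAverage (fun w => (opPoisson D ψ w : ℂ)) 0 1 = ((‖ψ‖ ^ 2 : ℝ) : ℂ) := by
  have hF : ∀ w : ℂ, ‖w‖ ≤ 1 → DifferentiableAt ℂ (fun w => inner ℂ ψ (neumann D w ψ)) w :=
    fun w => differentiableAt_inner_neumann hD ψ ψ
  rw [circleAverage_add_conj (A := fun w => inner ℂ ψ (neumann D w ψ) - ((‖ψ‖ ^ 2 : ℝ) : ℂ))
    (fun w hw => (hF w hw).sub_const _) hF
    (fun w _ => by rw [ofReal_opPoisson]; ring)]
  simp only [neumann_zero, one_apply_eq_self, inner_self_ofReal, Complex.conj_ofReal]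
  ring

/-- The Poisson representation of a Möbius transform of a strict contraction. -/
theorem circleAverage_mobius (hD : ‖D‖ < 1) (ψ : 𝓗) (hz : ‖z‖ < 1) :
    Real.circleAverage (fun w => (1 - w) / (w - z) * (opPoisson D ψ w : ℂ)) 0 1 =
      inner ℂ ψ (((D - 1) * neumann D z) ψ) := by
  have hDw : ∀ w : ℂ, ‖w‖ ≤ 1 → ‖w‖ * ‖D‖ < 1 := fun w => norm_mul_norm_lt_one hD
  set F : ℂ → ℂ := fun w => inner ℂ ψ (neumann D w ψ) with hFdef
  set G : ℂ → ℂ := fun w => inner ℂ (ContinuousLinearMap.adjoint D ψ)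
    (neumann D w (neumann D z ψ)) with hGdef
  set c : ℂ := ((‖ψ‖ ^ 2 : ℝ) : ℂ) with hc
  have hF : ∀ w : ℂ, ‖w‖ ≤ 1 → DifferentiableAt ℂ F w :=
    fun w => differentiableAt_inner_neumann hD ψ ψ
  have hG : ∀ w : ℂ, ‖w‖ ≤ 1 → DifferentiableAt ℂ G w :=
    fun w => differentiableAt_inner_neumann hD _ _
  -- Divided difference of `F` at `z`, supplied by the resolvent identity for `(1 - w D)⁻¹`; it
  -- cancels the pole of `(1 - w) / (w - z)` in the holomorphic part.
  have hFG : ∀ w : ℂ, ‖w‖ ≤ 1 → F w = F z + (w - z) * G w := by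
    intro w hw
    have hop : neumann D w = neumann D z + (w - z) • (D * (neumann D w * neumann D z)) := by
      have hcm := neumann_commute (hDw w hw)
      calc neumann D w = neumann D w * ((1 - z • D) * neumann D z) := by
            rw [mul_neumann (hDw z hz.le), mul_one]
        _ = neumann D w * ((1 - w • D) + (w - z) • D) * neumann D z := by
            rw [← mul_assoc]; congr 2; module
        _ = neumann D z + (w - z) • (D * (neumann D w * neumann D z)) := by
            rw [mul_add, neumann_mul (hDw w hw), add_mul, one_mul, mul_smul_comm,
              ← hcm.eq, smul_mul_assoc, mul_assoc]
    have := congrArg (fun T : 𝓗 →L[ℂ] 𝓗 => inner ℂ ψ (T ψ)) hop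
    simp only [add_apply, smul_apply, mul_apply_eq_comp, inner_add_right,
      inner_smul_right] at this
    rw [hFdef, hGdef]
    simp only [ContinuousLinearMap.adjoint_inner_left]
    exact this
  have hden : ∀ w : ℂ, ‖w‖ ≤ 1 → 1 - conj z * w ≠ 0 := by
    intro w hw h0
    have h1 : ‖conj z * w‖ < 1 := by
      rw [norm_mul, RCLike.norm_conj]
      exact (mul_le_of_le_one_right (norm_nonneg _) hw).trans_lt hz
    rw [← sub_eq_zero.mp h0, norm_one] at h1
    exact lt_irrefl _ h1
  have hq : ∀ w : ℂ, ‖w‖ ≤ 1 → DifferentiableAt ℂ (fun w => w / (1 - conj z * w)) w :=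
    fun w hw => DifferentiableAt.div (by fun_prop) (by fun_prop) (hden w hw)
  -- Use `(1 - w) / (w - z) = -1 + (1 - z) / (w - z)`. On the circle `1 / (w - z)` is the conjugate
  -- of `w / (1 - conj z * w)`, which is holomorphic on the closed disc, so the remaining pole terms
  -- go into the antiholomorphic part, where they vanish at the centre.
  rw [circleAverage_add_conj (A := fun w => -F w + (1 - z) * G w + c)
    (B := fun w => -F w + ((1 - conj z) * F w + conj ((1 - z) * (F z - c))) *
      (w / (1 - conj z * w)))]
  · have h0 : F 0 = c := by
      simp only [hFdef, neumann_zero, one_apply_eq_self, inner_self_ofReal, hc]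
    have hG0 : G 0 = inner ℂ ψ (D (neumann D z ψ)) := by
      simp only [hGdef, neumann_zero, one_apply_eq_self,
        ContinuousLinearMap.adjoint_inner_left]
    have hFz : F z = c + z * G 0 := by
      have := hFG 0 (by simp)
      rw [h0] at this
      rw [this]; ring
    have hcc : conj c = c := Complex.conj_ofReal _
    simp only [mul_apply_eq_comp, sub_apply,
      one_apply_eq_self, inner_sub_right]
    rw [← hG0]
    change _ = G 0 - F z
    rw [hFz, h0]
    simp only [zero_div, mul_zero, add_zero, map_neg, hcc]
    ring
  · exact fun w hw => ((hF w hw).neg.add ((hG w hw).const_mul _)).add_const _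
  · exact fun w hw => (hF w hw).neg.add ((((hF w hw).const_mul _).add_const _).mul (hq w hw))
  · intro w hw
    have hwz : w - z ≠ 0 := by
      intro h
      rw [sub_eq_zero.mp h] at hw
      exact hz.ne hw
    have hwc : conj w = w⁻¹ := by
      rw [Complex.inv_def, Complex.normSq_eq_norm_sq, hw]; simp
    have hw0 : w ≠ 0 := by
      intro h; rw [h, norm_zero] at hw; exact zero_ne_one hw
    have hconj : conj (w / (1 - conj z * w)) = 1 / (w - z) := by
      rw [map_div₀, map_sub, map_mul, Complex.conj_conj, hwc, map_one]
      have : 1 - z * w⁻¹ ≠ 0 := by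
        intro h0
        apply hwz
        field_simp at h0
        simpa using h0
      field_simp
    rw [map_add, map_mul, hconj, ofReal_opPoisson]
    simp only [map_add, map_neg, map_mul, map_sub, Complex.conj_conj, map_one]
    change (1 - w) / (w - z) * (F w + conj (F w) - c) = _
    rw [hFG w hw.le]
    have hcc : conj c = c := Complex.conj_ofReal _
    simp only [map_add, map_mul, map_sub]
    field_simp
    ring

end Contraction

/-! ### Scalar Poisson kernels and the Cayley transform. -/

section PoissonKernel

/-- Summing a Poisson kernel of width `ε` against a measure costs at most `2π / ε` times the
concentration of the measure at scale `ε`. -/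
theorem lintegral_poisson_le (μ : Measure ℝ) [SFinite μ] {ε : ℝ} (hε : 0 < ε) (x₀ : ℝ) :
    ∫⁻ t, ENNReal.ofReal (ε / ((t - x₀) ^ 2 + ε ^ 2)) ∂μ ≤
      ENNReal.ofReal (2 * Real.pi / ε) * ⨆ a : ℝ, μ (Icc a (a + ε)) := by
  set f : ℝ → ℝ≥0∞ := fun y => ENNReal.ofReal (2 / ε * (ε / ((y - x₀) ^ 2 + ε ^ 2))) with hf
  have hfm : Measurable f := by fun_prop
  have hfint : ∫⁻ y, f y = ENNReal.ofReal (2 * Real.pi / ε) := by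
    have h1 := lintegral_cauchyPDF_eq_one x₀ (γ := ε.toNNReal)
      (Real.toNNReal_pos.mpr hε).ne'
    have h2 : ∀ y, f y = ENNReal.ofReal (2 * Real.pi / ε) * cauchyPDF x₀ ε.toNNReal y := by
      intro y
      rw [cauchyPDF_def, ← ENNReal.ofReal_mul (by positivity), cauchyPDFReal_def,
        Real.coe_toNNReal _ hε.le]
      refine congrArg ENNReal.ofReal ?_
      have := Real.pi_ne_zero
      field_simp
    simp_rw [h2]
    rw [lintegral_const_mul _ (measurable_cauchyPDF _ _), h1, mul_one]
  -- Harnack-type comparison: moving the argument by at most `ε / 2` changes the kernel by a factor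
  -- at most `2`. So its value at `t` is at most twice its mean over the interval of length `ε`
  -- around `t`, and Tonelli turns the sum over `t` into masses of intervals of length `ε`.
  have hpt : ∀ t, ENNReal.ofReal (ε / ((t - x₀) ^ 2 + ε ^ 2)) ≤
      ∫⁻ y, {q : ℝ × ℝ | |q.2 - q.1| ≤ ε / 2}.indicator (fun q => f q.2) (t, y) := by
    intro t
    have h1 : ∀ y, {q : ℝ × ℝ | |q.2 - q.1| ≤ ε / 2}.indicator (fun q => f q.2) (t, y) =
        (Icc (t - ε / 2) (t + ε / 2)).indicator f y := by
      intro y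
      have : (t, y) ∈ {q : ℝ × ℝ | |q.2 - q.1| ≤ ε / 2} ↔ y ∈ Icc (t - ε / 2) (t + ε / 2) := by
        simp only [Set.mem_ofPred_eq, abs_le, mem_Icc]
        constructor <;> rintro ⟨h1, h2⟩ <;> constructor <;> linarith
      by_cases hy : y ∈ Icc (t - ε / 2) (t + ε / 2)
      · rw [indicator_of_mem hy, indicator_of_mem (this.mpr hy)]
      · rw [indicator_of_notMem hy, indicator_of_notMem (mt this.mp hy)]
    simp_rw [h1]
    rw [lintegral_indicator measurableSet_Icc]
    calc ENNReal.ofReal (ε / ((t - x₀) ^ 2 + ε ^ 2))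
        = ∫⁻ _ in Icc (t - ε / 2) (t + ε / 2),
            ENNReal.ofReal (1 / ε * (ε / ((t - x₀) ^ 2 + ε ^ 2))) := by
          rw [setLIntegral_const, Real.volume_Icc, ← ENNReal.ofReal_mul (by positivity)]
          congr 1
          field_simp
          ring
      _ ≤ _ := by
          refine setLIntegral_mono hfm fun y hy => ENNReal.ofReal_le_ofReal ?_
          have h2 : (y - x₀) ^ 2 + ε ^ 2 ≤ 2 * ((t - x₀) ^ 2 + ε ^ 2) := by
            have h3 : (y - t) ^ 2 ≤ (ε / 2) ^ 2 :=
              sq_le_sq' (by linarith [hy.1]) (by linarith [hy.2])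
            nlinarith [sq_nonneg ((t - x₀) - (y - t))]
          have h4 : ε / ((t - x₀) ^ 2 + ε ^ 2) ≤ 2 * (ε / ((y - x₀) ^ 2 + ε ^ 2)) := by
            rw [mul_div_assoc', div_le_div_iff₀ (by positivity) (by positivity)]
            nlinarith
          calc 1 / ε * (ε / ((t - x₀) ^ 2 + ε ^ 2))
              ≤ 1 / ε * (2 * (ε / ((y - x₀) ^ 2 + ε ^ 2))) := by
                gcongr
            _ = _ := by ring
  have hms : MeasurableSet {q : ℝ × ℝ | |q.2 - q.1| ≤ ε / 2} :=
    measurableSet_le (by fun_prop) (by fun_prop)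
  calc ∫⁻ t, ENNReal.ofReal (ε / ((t - x₀) ^ 2 + ε ^ 2)) ∂μ
      ≤ ∫⁻ t, (∫⁻ y, {q : ℝ × ℝ | |q.2 - q.1| ≤ ε / 2}.indicator
          (fun q => f q.2) (t, y)) ∂μ :=
        lintegral_mono hpt
    _ = ∫⁻ y, ∫⁻ t, {q : ℝ × ℝ | |q.2 - q.1| ≤ ε / 2}.indicator (fun q => f q.2) (t, y) ∂μ :=
        lintegral_lintegral_swap (μ := μ) (ν := volume) (f := fun t y =>
          {q : ℝ × ℝ | |q.2 - q.1| ≤ ε / 2}.indicator (fun q => f q.2) (t, y))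
          ((hfm.comp measurable_snd).indicator hms).aemeasurable
    _ ≤ ∫⁻ y, f y * ⨆ a : ℝ, μ (Icc a (a + ε)) := by
        refine lintegral_mono fun y => ?_
        have h1 : ∀ t, {q : ℝ × ℝ | |q.2 - q.1| ≤ ε / 2}.indicator (fun q => f q.2) (t, y) =
            (Icc (y - ε / 2) (y - ε / 2 + ε)).indicator (fun _ => f y) t := by
          intro t
          have : (t, y) ∈ {q : ℝ × ℝ | |q.2 - q.1| ≤ ε / 2} ↔
              t ∈ Icc (y - ε / 2) (y - ε / 2 + ε) := by
            simp only [Set.mem_ofPred_eq, abs_le, mem_Icc]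
            constructor <;> rintro ⟨h1, h2⟩ <;> constructor <;> linarith
          by_cases ht : t ∈ Icc (y - ε / 2) (y - ε / 2 + ε)
          · rw [indicator_of_mem ht, indicator_of_mem (this.mpr ht)]
          · rw [indicator_of_notMem ht, indicator_of_notMem (mt this.mp ht)]
        simp_rw [h1]
        rw [lintegral_indicator measurableSet_Icc, setLIntegral_const]
        gcongr
        exact le_iSup (fun a : ℝ => μ (Icc a (a + ε))) (y - ε / 2)
    _ = _ := by rw [lintegral_mul_const _ hfm, hfint]

/-- The Cayley transform of `x ↦ (t - x)⁻¹`, as a function on the unit circle. -/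
def cayleyKernel (ε t : ℝ) (w : ℂ) : ℂ := (1 - w) / (t * (1 - w) + 2 * Complex.I * ε * w)

theorem cayleyKernel_one (ε t : ℝ) : cayleyKernel ε t 1 = 0 := by simp [cayleyKernel]

/-- On the circle `w / (1 - w)` has real part `-1/2`, so the kernel is `(t - x₀ - iε)⁻¹` with `x₀`
real and independent of `t`. -/
theorem exists_cayleyKernel_im (ε : ℝ) {w : ℂ} (hw : ‖w‖ = 1) (hw1 : w ≠ 1) :
    ∃ x₀ : ℝ, ∀ t, (cayleyKernel ε t w).im = ε / ((t - x₀) ^ 2 + ε ^ 2) := by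
  have h1 : 1 - w ≠ 0 := sub_ne_zero.mpr hw1.symm
  have hw0 : w ≠ 0 := by
    intro h; rw [h, norm_zero] at hw; exact zero_ne_one hw
  have hwc : conj w = w⁻¹ := by
    rw [Complex.inv_def, Complex.normSq_eq_norm_sq, hw]; simp
  have h2 : w - 1 ≠ 0 := sub_ne_zero.mpr hw1
  have hsum : w / (1 - w) + conj (w / (1 - w)) = -1 := by
    have h3 : 1 - w⁻¹ ≠ 0 := by
      intro h; apply h2; field_simp at h; simpa using h
    have h4 : w⁻¹ / (1 - w⁻¹) = -(1 / (1 - w)) := by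
      rw [div_eq_iff h3]; field_simp; ring
    rw [map_div₀, map_sub, map_one, hwc, h4]
    field_simp
    ring
  have hre : (w / (1 - w)).re = -1 / 2 := by
    rw [Complex.add_conj] at hsum
    have : 2 * (w / (1 - w)).re = -1 := by exact_mod_cast hsum
    linarith
  refine ⟨2 * ε * (w / (1 - w)).im, fun t => ?_⟩
  have h5 : cayleyKernel ε t w = (t + 2 * Complex.I * ε * (w / (1 - w)))⁻¹ := by
    rw [cayleyKernel, ← inv_div]
    congr 1
    field_simp
  have h6 : (t : ℂ) + 2 * Complex.I * ε * (w / (1 - w)) =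
      ((t - 2 * ε * (w / (1 - w)).im : ℝ) : ℂ) + ((-ε : ℝ) : ℂ) * Complex.I := by
    apply Complex.ext
    · simp; ring
    · simp [hre]; ring
  rw [h5, h6, Complex.inv_im, Complex.normSq_add_mul_I]
  simp

theorem cayleyKernel_im_nonneg {ε : ℝ} (hε : 0 < ε) (t : ℝ) {w : ℂ} (hw : ‖w‖ = 1) :
    0 ≤ (cayleyKernel ε t w).im := by
  by_cases hw1 : w = 1
  · rw [hw1, cayleyKernel_one]; rfl
  · obtain ⟨x₀, h⟩ := exists_cayleyKernel_im ε hw hw1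
    rw [h]; positivity

theorem lintegral_cayleyKernel_le (μ : Measure ℝ) [SFinite μ] {ε : ℝ} (hε : 0 < ε) {w : ℂ}
    (hw : ‖w‖ = 1) :
    ∫⁻ t, ENNReal.ofReal (cayleyKernel ε t w).im ∂μ ≤
      ENNReal.ofReal (2 * Real.pi / ε) * ⨆ a : ℝ, μ (Icc a (a + ε)) := by
  by_cases hw1 : w = 1
  · simp [hw1, cayleyKernel_one]
  · obtain ⟨x₀, h⟩ := exists_cayleyKernel_im ε hw hw1
    simp_rw [h]
    exact lintegral_poisson_le μ hε x₀

theorem cayleyKernel_denom_ne_zero {ε : ℝ} (hε : 0 < ε) (t : ℝ) {w : ℂ} (hw : ‖w‖ = 1) :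
    (t : ℂ) * (1 - w) + 2 * Complex.I * ε * w ≠ 0 := by
  intro h
  have h1 : (t - 2 * Complex.I * ε) * w = t := by linear_combination -h
  have h2 := congrArg (fun x : ℂ => Complex.normSq x) h1
  simp only [map_mul] at h2
  rw [Complex.normSq_eq_norm_sq w, hw] at h2
  simp [Complex.normSq_apply] at h2
  exact hε.ne' h2

theorem two_I_mul_sub_ne_zero {ε : ℝ} (hε : 0 < ε) (t : ℝ) : 2 * Complex.I * ε - (t : ℂ) ≠ 0 := by
  intro h
  have := congrArg Complex.im h
  simp at this
  exact hε.ne' this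

/-- The point of the unit disc that corresponds to the real point `t`. -/
def cayleyPoint (ε t : ℝ) : ℂ := t / (t - 2 * Complex.I * ε)

theorem norm_cayleyPoint_lt_one {ε : ℝ} (hε : 0 < ε) (t : ℝ) : ‖cayleyPoint ε t‖ < 1 := by
  have h0 : (t : ℂ) - 2 * Complex.I * ε ≠ 0 := by
    rw [← neg_sub, neg_ne_zero]; exact two_I_mul_sub_ne_zero hε t
  rw [cayleyPoint, norm_div, div_lt_one (norm_pos_iff.mpr h0)]
  refine lt_of_pow_lt_pow_left₀ 2 (norm_nonneg _) ?_
  rw [← Complex.normSq_eq_norm_sq, ← Complex.normSq_eq_norm_sq, Complex.normSq_apply,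
    Complex.normSq_apply]
  simp
  positivity

theorem continuous_cayleyPoint {ε : ℝ} (hε : 0 < ε) : Continuous (cayleyPoint ε) := by
  refine Continuous.div (by fun_prop) (by fun_prop) fun t => ?_
  rw [← neg_sub, neg_ne_zero]; exact two_I_mul_sub_ne_zero hε t

theorem cayleyKernel_eq {ε : ℝ} (hε : 0 < ε) (t : ℝ) {w : ℂ} (hw : ‖w‖ = 1) :
    cayleyKernel ε t w =
      (2 * Complex.I * ε - (t : ℂ))⁻¹ * ((1 - w) / (w - cayleyPoint ε t)) := by
  have h1 := cayleyKernel_denom_ne_zero hε t hw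
  have h2 := two_I_mul_sub_ne_zero hε t
  have h3 : (t : ℂ) - 2 * Complex.I * ε ≠ 0 := by
    rw [← neg_sub, neg_ne_zero]; exact h2
  have h4 : (2 * Complex.I * ε - (t : ℂ)) * (w - cayleyPoint ε t) =
      (t : ℂ) * (1 - w) + 2 * Complex.I * ε * w := by
    rw [cayleyPoint]; field_simp; ring
  rw [cayleyKernel, ← h4]
  rw [inv_mul_eq_div, div_div, mul_comm]

end PoissonKernel

/-! ### Spectral averaging in the coupling constant. -/

section SpectralAveraging

theorem lintegral_lintegral_mul_le {α β : Type*} [MeasurableSpace α] [MeasurableSpace β]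
    {μ : Measure α} {ν : Measure β} [SFinite μ] [SFinite ν] {k : α → β → ℝ≥0∞} {p : β → ℝ≥0∞}
    (hk : Measurable (Function.uncurry k)) (hp : Measurable p) {M : ℝ≥0∞}
    (hM : ∀ y, ∫⁻ x, k x y ∂μ ≤ M) :
    ∫⁻ x, (∫⁻ y, k x y * p y ∂ν) ∂μ ≤ M * ∫⁻ y, p y ∂ν := by
  have hm : Measurable (Function.uncurry fun x y => k x y * p y) :=
    hk.mul (hp.comp measurable_snd)
  rw [lintegral_lintegral_swap hm.aemeasurable, ← lintegral_const_mul _ hp]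
  refine lintegral_mono fun y => ?_
  have hky : Measurable fun x => k x y := hk.comp (measurable_id.prodMk measurable_const)
  calc ∫⁻ x, k x y * p y ∂μ = (∫⁻ x, k x y ∂μ) * p y := lintegral_mul_const _ hky
    _ ≤ M * p y := mul_le_mul' (hM y) le_rfl

variable {𝓗 : Type*} [NormedAddCommGroup 𝓗] [InnerProductSpace ℂ 𝓗]

/-- The Möbius transform of a contraction that corresponds to `cayleyKernel`. -/
def cayleyTransform (D : 𝓗 →L[ℂ] 𝓗) (ε t : ℝ) : 𝓗 →L[ℂ] 𝓗 :=
  (2 * Complex.I * ε - (t : ℂ))⁻¹ • ((D - 1) * neumann D (cayleyPoint ε t))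

theorem norm_cayleyPoint_mul_lt_one {D : 𝓗 →L[ℂ] 𝓗} (hD : ‖D‖ ≤ 1) {ε : ℝ} (hε : 0 < ε) (t : ℝ) :
    ‖cayleyPoint ε t‖ * ‖D‖ < 1 :=
  (mul_le_of_le_one_right (norm_nonneg _) hD).trans_lt (norm_cayleyPoint_lt_one hε t)

variable [CompleteSpace 𝓗]

theorem continuous_opPoisson_circleMap {D : 𝓗 →L[ℂ] 𝓗} (hD : ‖D‖ < 1) (ψ : 𝓗) :
    Continuous fun θ : ℝ => opPoisson D ψ (circleMap 0 1 θ) := by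
  have h : ContinuousOn (opPoisson D ψ) (Metric.closedBall 0 1) := fun w hw => by
    have h1 := (differentiableAt_inner_neumann hD ψ ψ
      (mem_closedBall_zero_iff.mp hw)).continuousAt
    exact (((Complex.continuous_re.continuousAt.comp h1).const_mul 2).sub
      continuousAt_const).continuousWithinAt
  exact h.comp_continuous (continuous_circleMap 0 1) fun θ => by simp

theorem lintegral_opPoisson {D : 𝓗 →L[ℂ] 𝓗} (hD : ‖D‖ < 1) (ψ : 𝓗) :
    ∫⁻ θ in Ioc 0 (2 * Real.pi),
      ENNReal.ofReal ((2 * Real.pi)⁻¹ * opPoisson D ψ (circleMap 0 1 θ)) =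
      ENNReal.ofReal (‖ψ‖ ^ 2) := by
  have hc := continuous_opPoisson_circleMap hD ψ
  rw [← ofReal_integral_eq_lintegral_ofReal]
  · congr 1
    have h1 := circleAverage_opPoisson hD ψ
    rw [Real.circleAverage_def, intervalIntegral.integral_ofReal, Complex.real_smul,
      ← Complex.ofReal_mul, Complex.ofReal_inj,
      intervalIntegral.integral_of_le Real.two_pi_pos.le] at h1
    rw [integral_const_mul, h1]
  · exact (Continuous.integrableOn_Ioc (by fun_prop))
  · refine Filter.Eventually.of_forall fun θ => ?_
    have := opPoisson_nonneg hD ψ (w := circleMap 0 1 θ) (by simp)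
    positivity

theorem continuous_cayleyTransform {D : 𝓗 →L[ℂ] 𝓗} (hD : ‖D‖ ≤ 1) {ε : ℝ} (hε : 0 < ε) :
    Continuous (cayleyTransform D ε) := by
  have h1 : Continuous fun t => neumann D (cayleyPoint ε t) := continuous_iff_continuousAt.mpr
    fun t => (differentiableAt_neumann (norm_cayleyPoint_mul_lt_one hD hε t)).continuousAt.comp
      (continuous_cayleyPoint hε).continuousAt
  have h2 : Continuous fun t : ℝ => (2 * Complex.I * ε - (t : ℂ))⁻¹ :=
    Continuous.inv₀ (by fun_prop) (two_I_mul_sub_ne_zero hε)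
  exact h2.smul (continuous_const.mul h1)

theorem ofReal_im_inner_cayleyTransform {D : 𝓗 →L[ℂ] 𝓗} (hD : ‖D‖ < 1) {ε : ℝ} (hε : 0 < ε)
    (ψ : 𝓗) (t : ℝ) :
    ENNReal.ofReal (inner ℂ ψ (cayleyTransform D ε t ψ)).im =
      ∫⁻ θ in Ioc 0 (2 * Real.pi), ENNReal.ofReal (cayleyKernel ε t (circleMap 0 1 θ)).im *
        ENNReal.ofReal ((2 * Real.pi)⁻¹ * opPoisson D ψ (circleMap 0 1 θ)) := by
  have hnorm : ∀ θ, ‖circleMap 0 1 θ‖ = 1 := by simp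
  have hkc : Continuous fun θ : ℝ => cayleyKernel ε t (circleMap 0 1 θ) := by
    unfold cayleyKernel
    exact Continuous.div (by fun_prop) (by fun_prop)
      fun θ => cayleyKernel_denom_ne_zero hε t (hnorm θ)
  have hpc := continuous_opPoisson_circleMap hD ψ
  have hcont : Continuous fun θ : ℝ =>
      cayleyKernel ε t (circleMap 0 1 θ) * (opPoisson D ψ (circleMap 0 1 θ) : ℂ) := by fun_prop
  have h1 : inner ℂ ψ (cayleyTransform D ε t ψ) =
      Real.circleAverage (fun w => cayleyKernel ε t w * (opPoisson D ψ w : ℂ)) 0 1 := by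
    rw [cayleyTransform, smul_apply, inner_smul_right,
      ← circleAverage_mobius hD ψ (norm_cayleyPoint_lt_one hε t), ← smul_eq_mul,
      ← Real.circleAverage_fun_smul]
    refine Real.circleAverage_congr_sphere fun w hw => ?_
    rw [abs_one, mem_sphere_zero_iff_norm] at hw
    simp only [smul_eq_mul]
    rw [cayleyKernel_eq hε t hw]
    ring
  have h2 : (inner ℂ ψ (cayleyTransform D ε t ψ)).im =
      ∫ θ in Ioc 0 (2 * Real.pi), (cayleyKernel ε t (circleMap 0 1 θ)).im *
        ((2 * Real.pi)⁻¹ * opPoisson D ψ (circleMap 0 1 θ)) := by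
    rw [h1, Real.circleAverage_def, Complex.smul_im,
      intervalIntegral.integral_of_le Real.two_pi_pos.le, smul_eq_mul]
    have h3 := Complex.imCLM.integral_comp_comm (μ := volume.restrict (Ioc 0 (2 * Real.pi)))
      hcont.integrableOn_Ioc
    change ∫ θ in Ioc 0 (2 * Real.pi), _ = (∫ θ in Ioc 0 (2 * Real.pi), _ : ℂ).im at h3
    rw [← h3, ← integral_const_mul]
    refine integral_congr_ae (Filter.Eventually.of_forall fun θ => ?_)
    simp only [Complex.imCLM_apply, Complex.im_mul_ofReal]
    ring
  have hnn : ∀ θ, 0 ≤ (cayleyKernel ε t (circleMap 0 1 θ)).im := fun θ =>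
    cayleyKernel_im_nonneg hε t (hnorm θ)
  rw [h2, ofReal_integral_eq_lintegral_ofReal]
  · refine lintegral_congr fun θ => ENNReal.ofReal_mul (hnn θ)
  · exact Continuous.integrableOn_Ioc (by fun_prop)
  · refine Filter.Eventually.of_forall fun θ => ?_
    have := opPoisson_nonneg hD ψ (w := circleMap 0 1 θ) (by simp)
    have := hnn θ
    positivity

theorem lintegral_cayleyTransform_le_of_norm_lt {D : 𝓗 →L[ℂ] 𝓗} (hD : ‖D‖ < 1) {ε : ℝ}
    (hε : 0 < ε) (ψ : 𝓗) (μ : Measure ℝ) [SFinite μ] :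
    ∫⁻ t, ENNReal.ofReal (inner ℂ ψ (cayleyTransform D ε t ψ)).im ∂μ ≤
      (ENNReal.ofReal (2 * Real.pi / ε) * ⨆ a : ℝ, μ (Icc a (a + ε))) *
        ENNReal.ofReal (‖ψ‖ ^ 2) := by
  have hpm : Measurable fun θ : ℝ =>
      ENNReal.ofReal ((2 * Real.pi)⁻¹ * opPoisson D ψ (circleMap 0 1 θ)) := by
    have := (continuous_opPoisson_circleMap hD ψ).measurable
    fun_prop
  have hkm : Measurable (Function.uncurry fun t θ : ℝ =>
      ENNReal.ofReal (cayleyKernel ε t (circleMap 0 1 θ)).im) := by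
    have hc : Continuous fun θ : ℝ => circleMap 0 1 θ := continuous_circleMap 0 1
    have : Measurable fun θ : ℝ => circleMap 0 1 θ := hc.measurable
    unfold cayleyKernel Function.uncurry
    fun_prop
  have hle := lintegral_lintegral_mul_le (μ := μ) (ν := volume.restrict (Ioc 0 (2 * Real.pi)))
    hkm hpm fun θ => lintegral_cayleyKernel_le μ hε (w := circleMap 0 1 θ) (by simp)
  rw [lintegral_opPoisson hD ψ] at hle
  refine le_trans (le_of_eq ?_) hle
  exact lintegral_congr fun t => ofReal_im_inner_cayleyTransform hD hε ψ t

/-- The Poisson density needs `‖C‖ < 1`. Scale `C` by `1 - 1/(n+1)`: the bound is uniform in `n`,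
the integrand converges pointwise because `cayleyPoint` stays inside the open disc, and Fatou passes
to the limit. -/
theorem lintegral_cayleyTransform_le {C : 𝓗 →L[ℂ] 𝓗} (hC : ‖C‖ ≤ 1) {ε : ℝ}
    (hε : 0 < ε) (ψ : 𝓗) (μ : Measure ℝ) [SFinite μ] :
    ∫⁻ t, ENNReal.ofReal (inner ℂ ψ (cayleyTransform C ε t ψ)).im ∂μ ≤
      (ENNReal.ofReal (2 * Real.pi / ε) * ⨆ a : ℝ, μ (Icc a (a + ε))) *
        ENNReal.ofReal (‖ψ‖ ^ 2) := by
  set D : ℕ → 𝓗 →L[ℂ] 𝓗 := fun n => ((1 - 1 / ((n : ℝ) + 1) : ℝ) : ℂ) • C with hD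
  have hDlim : Filter.Tendsto D Filter.atTop (nhds C) := by
    have h1 : Filter.Tendsto (fun n : ℕ => (1 - 1 / ((n : ℝ) + 1) : ℝ)) Filter.atTop (nhds 1) := by
      simpa using tendsto_one_div_add_atTop_nhds_zero_nat.const_sub (1 : ℝ)
    have h2 := ((Complex.continuous_ofReal.tendsto 1).comp h1).smul_const C
    rw [Complex.ofReal_one, one_smul] at h2
    exact h2
  have hDnorm : ∀ n, ‖D n‖ < 1 := by
    intro n
    have h1 : (0 : ℝ) < 1 / ((n : ℝ) + 1) := by positivity
    have h2 : 1 / ((n : ℝ) + 1) ≤ 1 := by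
      rw [div_le_one (by positivity)]; linarith [(Nat.cast_nonneg n : (0 : ℝ) ≤ n)]
    rw [hD]
    simp only
    rw [norm_smul, Complex.norm_real, Real.norm_of_nonneg (by linarith)]
    nlinarith [norm_nonneg C]
  have hlim : ∀ t, Filter.Tendsto
      (fun n => ENNReal.ofReal (inner ℂ ψ (cayleyTransform (D n) ε t ψ)).im) Filter.atTop
      (nhds (ENNReal.ofReal (inner ℂ ψ (cayleyTransform C ε t ψ)).im)) := by
    intro t
    have hu := isUnit_one_sub_smul (norm_cayleyPoint_mul_lt_one hC hε t)
    have h1 : ContinuousAt Ring.inverse (1 - cayleyPoint ε t • C) := by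
      obtain ⟨x, hx⟩ := hu
      exact hx ▸ NormedRing.inverse_continuousAt x
    have h2 : ContinuousAt (fun D : 𝓗 →L[ℂ] 𝓗 => neumann D (cayleyPoint ε t)) C :=
      h1.comp (f := fun D : 𝓗 →L[ℂ] 𝓗 => 1 - cayleyPoint ε t • D)
        (Continuous.continuousAt (by fun_prop))
    have h3 : ContinuousAt (fun D : 𝓗 →L[ℂ] 𝓗 => cayleyTransform D ε t) C :=
      ContinuousAt.fun_const_smul ((continuousAt_id.sub continuousAt_const).mul h2) _
    have h4 : Continuous fun T : 𝓗 →L[ℂ] 𝓗 => ENNReal.ofReal (inner ℂ ψ (T ψ)).im :=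
      ENNReal.continuous_ofReal.comp (by fun_prop)
    exact (h4.continuousAt.tendsto.comp h3.tendsto).comp hDlim
  calc ∫⁻ t, ENNReal.ofReal (inner ℂ ψ (cayleyTransform C ε t ψ)).im ∂μ
      = ∫⁻ t, Filter.liminf (fun n =>
          ENNReal.ofReal (inner ℂ ψ (cayleyTransform (D n) ε t ψ)).im) Filter.atTop ∂μ :=
        lintegral_congr fun t => (hlim t).liminf_eq.symm
    _ ≤ Filter.liminf (fun n =>
          ∫⁻ t, ENNReal.ofReal (inner ℂ ψ (cayleyTransform (D n) ε t ψ)).im ∂μ) Filter.atTop := by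
        refine lintegral_liminf_le fun n => Continuous.measurable ?_
        have := continuous_cayleyTransform (hDnorm n).le hε
        exact ENNReal.continuous_ofReal.comp (by fun_prop)
    _ ≤ _ := by
        refine Filter.liminf_le_of_le (by isBoundedDefault) fun b hb => ?_
        obtain ⟨n, hn⟩ := hb.exists
        exact hn.trans (lintegral_cayleyTransform_le_of_norm_lt (hDnorm n) hε ψ μ)

theorem exists_sqrt {U : 𝓗 →L[ℂ] 𝓗} (hU : U.IsPositive) (hU1 : ‖U‖ ≤ 1) :
    ∃ B : 𝓗 →L[ℂ] 𝓗, IsSelfAdjoint B ∧ B * B = U ∧ ‖B‖ ≤ 1 := by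
  have hU' : 0 ≤ U := (ContinuousLinearMap.nonneg_iff_isPositive U).mpr hU
  have hs : IsSelfAdjoint (CFC.sqrt U) := (CFC.sqrt_nonneg U).isSelfAdjoint
  have hm := CFC.sqrt_mul_sqrt_self U hU'
  refine ⟨CFC.sqrt U, hs, hm, ?_⟩
  have h2 : ‖CFC.sqrt U‖ * ‖CFC.sqrt U‖ ≤ 1 := by
    rw [← CStarRing.norm_star_mul_self, hs.star_eq, hm]; exact hU1
  nlinarith [norm_nonneg (CFC.sqrt U)]

/-- For `C = 1 + 2iε K₀` and `z = cayleyPoint ε t` one has `(2iε - t)(1 - z C) = 2iε (1 + t K₀)`.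
The left side is invertible, so the relation `K (1 + t K₀) = K₀` can be solved for `K`. -/
theorem eq_cayleyTransform {K₀ K : 𝓗 →L[ℂ] 𝓗} {ε t : ℝ} (hε : 0 < ε)
    (hC : ‖1 + (2 * Complex.I * ε) • K₀‖ ≤ 1) (hK : K + (t : ℂ) • (K * K₀) = K₀) :
    K = cayleyTransform (1 + (2 * Complex.I * ε) • K₀) ε t := by
  set C := 1 + (2 * Complex.I * ε) • K₀ with hCdef
  have h0 := two_I_mul_sub_ne_zero hε t
  have h0' : (t : ℂ) - 2 * Complex.I * ε ≠ 0 := by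
    rw [← neg_sub, neg_ne_zero]; exact h0
  have hn := mul_neumann (norm_cayleyPoint_mul_lt_one hC hε t)
  have h1 : (2 * Complex.I * ε - (t : ℂ)) • (1 - cayleyPoint ε t • C) =
      (2 * Complex.I * ε) • (1 + (t : ℂ) • K₀) := by
    have h2 : (2 * Complex.I * ε - (t : ℂ)) * cayleyPoint ε t = -t := by
      rw [cayleyPoint]; field_simp; ring
    rw [smul_sub, smul_smul, h2, hCdef]
    module
  have h3 : (2 * Complex.I * ε - (t : ℂ)) • (K * (1 - cayleyPoint ε t • C)) = C - 1 := by
    rw [← mul_smul_comm, h1, mul_smul_comm, mul_add, mul_one, mul_smul_comm, hK, hCdef]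
    abel
  rw [cayleyTransform, ← h3, smul_mul_assoc, mul_assoc K, hn, mul_one, smul_smul,
    inv_mul_cancel₀ h0, one_smul]

/-- Spectral averaging over the coupling constant of a bounded nonnegative perturbation. -/
theorem lintegral_resolvent_le {H : 𝓗 →ₗ.[ℂ] 𝓗} (hH : IsSelfAdjoint H) {U : 𝓗 →L[ℂ] 𝓗}
    (hU : U.IsPositive) (hU1 : ‖U‖ ≤ 1) {ε : ℝ} (hε : 0 < ε) (E : ℝ) (φ : 𝓗)
    (μ : Measure ℝ) [SFinite μ] :
    ∫⁻ t, ENNReal.ofReal (inner ℂ φ (U (resolvent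
        ((((t : ℂ) • U : 𝓗 →L[ℂ] 𝓗) : 𝓗 →ₗ[ℂ] 𝓗) +ᵥ H)
        ((E : ℂ) + Complex.I * (ε : ℂ)) (U φ)))).im ∂μ ≤
      (ENNReal.ofReal (2 * Real.pi / ε) * ⨆ a : ℝ, μ (Icc a (a + ε))) *
        ENNReal.ofReal (‖φ‖ ^ 2) := by
  obtain ⟨B, hB, hBU, hB1⟩ := exists_sqrt hU hU1
  have hBU' : ∀ v, B (B v) = U v := fun v => congrArg (fun T : 𝓗 →L[ℂ] 𝓗 => T v) hBU
  have hBs : ∀ x y, inner ℂ (B x) y = inner ℂ x (B y) := fun x y => hB.isSymmetric x y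
  have hBn : ∀ v, ‖B v‖ ≤ ‖v‖ := fun v => (B.le_opNorm v).trans
    (mul_le_of_le_one_left (norm_nonneg _) hB1)
  set z : ℂ := (E : ℂ) + Complex.I * (ε : ℂ) with hz
  have hzim : z.im = ε := by simp [hz]
  have hzne : z.im ≠ 0 := by rw [hzim]; exact hε.ne'
  set R : ℝ → 𝓗 →L[ℂ] 𝓗 := fun t =>
    resolvent ((((t : ℂ) • U : 𝓗 →L[ℂ] 𝓗) : 𝓗 →ₗ[ℂ] 𝓗) +ᵥ H) z with hR
  have hsa : ∀ t : ℝ, IsSelfAdjoint ((((t : ℂ) • U : 𝓗 →L[ℂ] 𝓗) : 𝓗 →ₗ[ℂ] 𝓗) +ᵥ H) := fun t =>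
    isSelfAdjoint_vadd hH (IsSelfAdjoint.smul (Complex.conj_ofReal t) hU.isSelfAdjoint)
  have hres : ∀ t : ℝ, IsResolventAt ((((t : ℂ) • U : 𝓗 →L[ℂ] 𝓗) : 𝓗 →ₗ[ℂ] 𝓗) +ᵥ H) z (R t) :=
    fun t => isResolventAt_resolvent (hsa t) hzne
  set K : ℝ → 𝓗 →L[ℂ] 𝓗 := fun t => B * R t * B with hK
  -- The resolvent satisfies this with equality; sandwiching by `B` with `‖B‖ ≤ 1` leaves an
  -- inequality.
  have hdiss : ∀ v, ε * ‖K 0 v‖ ^ 2 ≤ (inner ℂ v (K 0 v)).im := by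
    intro v
    change ε * ‖B (R 0 (B v))‖ ^ 2 ≤ (inner ℂ v (B (R 0 (B v)))).im
    rw [← hBs, (hres 0).inner_im (hsa 0), hzim]
    gcongr
    exact hBn _
  -- Expanding the square gives `‖v‖² - 4ε (Im ⟨v, K 0 v⟩ - ε ‖K 0 v‖²)`.
  have hC : ‖1 + (2 * Complex.I * ε) • K 0‖ ≤ 1 := by
    refine ContinuousLinearMap.opNorm_le_bound _ zero_le_one fun v => ?_
    rw [one_mul]
    refine le_of_sq_le_sq ?_ (norm_nonneg _)
    change ‖v + (2 * Complex.I * ε) • K 0 v‖ ^ 2 ≤ ‖v‖ ^ 2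
    rw [norm_add_sq (𝕜 := ℂ), inner_smul_right, norm_smul]
    have h1 : RCLike.re (2 * Complex.I * ε * inner ℂ v (K 0 v)) =
        -(2 * ε * (inner ℂ v (K 0 v)).im) := by
      change (2 * Complex.I * ε * inner ℂ v (K 0 v)).re = _
      simp
    have h2 : ‖2 * Complex.I * (ε : ℂ)‖ = 2 * ε := by simp [abs_of_pos hε]
    rw [h1, h2]
    nlinarith [mul_le_mul_of_nonneg_left (hdiss v) hε.le]
  have hKt : ∀ t : ℝ, K t + (t : ℂ) • (K t * K 0) = K 0 := by
    intro t
    have h := resolvent_sub_resolvent (hres t) (hres 0)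
    have h' : R t + (t : ℂ) • (R t * U * R 0) = R 0 := by
      have h2 : R t ∘L ((((0 : ℝ) : ℂ) • U - (t : ℂ) • U + (z - z) • 1) ∘L R 0) =
          -((t : ℂ) • (R t * U * R 0)) := by
        ext v; simp [mul_apply_eq_comp]
      rw [h2, sub_eq_iff_eq_add, add_comm, ← sub_eq_add_neg] at h
      exact (eq_sub_iff_add_eq.mp h)
    calc K t + (t : ℂ) • (K t * K 0) = B * (R t + (t : ℂ) • (R t * (B * B) * R 0)) * B := by
          simp only [hK, mul_add, add_mul, mul_smul_comm, smul_mul_assoc, mul_assoc]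
      _ = K 0 := by rw [hBU, h']
  have hpt : ∀ t, inner ℂ φ (U (R t (U φ))) =
      inner ℂ (B φ) (cayleyTransform (1 + (2 * Complex.I * ε) • K 0) ε t (B φ)) := by
    intro t
    rw [← eq_cayleyTransform hε hC (hKt t), ← hBU' φ, ← hBU', hBs]
    rfl
  refine (lintegral_congr fun t => congrArg (fun x : ℂ => ENNReal.ofReal x.im) (hpt t)).trans_le ?_
  refine (lintegral_cayleyTransform_le hC hε (B φ) μ).trans ?_
  gcongr
  exact hBn φ

end SpectralAveraging

/-! ### Single-site potentials and the local Hamiltonian. -/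

section SiteOperators

variable {d : ℕ} {u : EuclideanSpace ℝ (Fin d) → ℝ} (hu : MemLp u ∞ volume)
  (c : EuclideanSpace ℝ (Fin d)) (l : ℝ)

theorem coeFn_siteOp (j : Fin d → ℤ) (ψ : L2 c l) :
    siteOp hu c l j ψ =ᵐ[volume.restrict (cube c l)]
      fun x => (u (x - latticePoint j) : ℂ) * ψ x := by
  have h1 := ContinuousLinearMap.coeFn_holder (r := 2) (ContinuousLinearMap.mul ℂ ℂ)
    ((memLp_site hu c l j).toLp _) ψ
  have h2 := (memLp_site hu c l j).coeFn_toLp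
  filter_upwards [h1, h2] with x hx1 hx2
  change ContinuousLinearMap.holder 2 (ContinuousLinearMap.mul ℂ ℂ) _ ψ x = _
  rw [hx1, hx2]
  rfl

theorem ae_site {p : ℝ → Prop} (h : ∀ᵐ x, p (u x)) (j : Fin d → ℤ) :
    ∀ᵐ x ∂volume.restrict (cube c l), p (u (x - latticePoint j)) :=
  ae_restrict_of_ae
    ((measurePreserving_sub_right volume (latticePoint j)).quasiMeasurePreserving.ae h)

variable {c l}

theorem isPositive_siteOp (hu0 : ∀ᵐ x, 0 ≤ u x) (j : Fin d → ℤ) :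
    (siteOp hu c l j).IsPositive := by
  rw [ContinuousLinearMap.isPositive_iff_complex]
  intro ψ
  have h : inner ℂ (siteOp hu c l j ψ) ψ =
      ((∫ x in cube c l, u (x - latticePoint j) * ‖ψ x‖ ^ 2 : ℝ) : ℂ) := by
    rw [L2.inner_def, ← integral_complex_ofReal]
    refine integral_congr_ae ((coeFn_siteOp hu c l j ψ).mono fun x hx => ?_)
    simp only [hx]
    rw [RCLike.inner_apply, map_mul, Complex.conj_ofReal, mul_left_comm, RCLike.mul_conj]
    push_cast
    rfl
  rw [h]
  refine ⟨rfl, ?_⟩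
  change 0 ≤ ∫ x in cube c l, u (x - latticePoint j) * ‖ψ x‖ ^ 2
  exact integral_nonneg_of_ae ((ae_site c l (p := (0 ≤ ·)) hu0 j).mono fun x hx =>
    mul_nonneg hx (sq_nonneg _))

theorem norm_siteOp_le (hu0 : ∀ᵐ x, 0 ≤ u x) (hu1 : ∀ᵐ x, u x ≤ 1) (j : Fin d → ℤ) :
    ‖siteOp hu c l j‖ ≤ 1 := by
  refine ContinuousLinearMap.opNorm_le_bound _ zero_le_one fun ψ => ?_
  rw [one_mul]
  refine Lp.norm_le_norm_of_ae_le ?_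
  filter_upwards [coeFn_siteOp hu c l j ψ, ae_site c l (p := (0 ≤ ·)) hu0 j,
    ae_site c l (p := (· ≤ 1)) hu1 j] with x hx h0 h1
  rw [hx, norm_mul, Complex.norm_real, Real.norm_of_nonneg h0]
  exact mul_le_of_le_one_left (norm_nonneg _) h1

/-- The potential `t u_j + ∑_{k ≠ j} q_k u_k` as a bounded operator. -/
def sitePotential (c : EuclideanSpace ℝ (Fin d)) (l : ℝ) (q : (Fin d → ℤ) → ℝ) (j : Fin d → ℤ)
    (t : ℝ) : L2 c l →L[ℂ] L2 c l :=
  (t : ℂ) • siteOp hu c l j +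
    ∑ k ∈ latticePoints c l, (Function.update q j 0 k : ℂ) • siteOp hu c l k

theorem siteFamily_eq (H₀ : L2 c l →ₗ.[ℂ] L2 c l) (q : (Fin d → ℤ) → ℝ) (j : Fin d → ℤ) (t : ℝ) :
    siteFamily hu H₀ q j t =
      ((sitePotential hu c l q j t : L2 c l →L[ℂ] L2 c l) : L2 c l →ₗ[ℂ] L2 c l) +ᵥ H₀ := by
  rw [siteFamily, hamiltonian, vadd_vadd]
  rfl

theorem siteFamily_self (H₀ : L2 c l →ₗ.[ℂ] L2 c l) (q : (Fin d → ℤ) → ℝ) {j : Fin d → ℤ}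
    (hj : j ∈ latticePoints c l) : siteFamily hu H₀ q j (q j) = hamiltonian hu H₀ q := by
  rw [siteFamily_eq, hamiltonian, sitePotential]
  congr 2
  rw [← Finset.add_sum_erase _ _ hj, ← Finset.add_sum_erase (latticePoints c l)
    (fun k => (q k : ℂ) • siteOp hu c l k) hj]
  simp only [Function.update_self, Complex.ofReal_zero, zero_smul, zero_add]
  congr 1
  refine Finset.sum_congr rfl fun k hk => ?_
  rw [Function.update_of_ne (Finset.ne_of_mem_erase hk)]

theorem isSelfAdjoint_ofReal_smul_siteOp (hu0 : ∀ᵐ x, 0 ≤ u x) (t : ℝ) (j : Fin d → ℤ) :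
    IsSelfAdjoint ((t : ℂ) • siteOp hu c l j) :=
  IsSelfAdjoint.smul (Complex.conj_ofReal t) (isPositive_siteOp hu hu0 j).isSelfAdjoint

theorem isSelfAdjoint_potential (hu0 : ∀ᵐ x, 0 ≤ u x) (q : (Fin d → ℤ) → ℝ) :
    IsSelfAdjoint (∑ k ∈ latticePoints c l, (q k : ℂ) • siteOp hu c l k) :=
  isSelfAdjoint_sum _ fun k _ => isSelfAdjoint_ofReal_smul_siteOp hu hu0 (q k) k

theorem isSelfAdjoint_sitePotential (hu0 : ∀ᵐ x, 0 ≤ u x) (q : (Fin d → ℤ) → ℝ) (j : Fin d → ℤ)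
    (t : ℝ) : IsSelfAdjoint (sitePotential hu c l q j t) :=
  (isSelfAdjoint_ofReal_smul_siteOp hu hu0 t j).add (isSelfAdjoint_potential hu hu0 _)

theorem isSelfAdjoint_hamiltonian (hu0 : ∀ᵐ x, 0 ≤ u x) {H₀ : L2 c l →ₗ.[ℂ] L2 c l}
    (hH₀ : IsSelfAdjoint H₀) (q : (Fin d → ℤ) → ℝ) : IsSelfAdjoint (hamiltonian hu H₀ q) :=
  isSelfAdjoint_vadd hH₀ (isSelfAdjoint_potential hu hu0 q)

/-- `Im ⟨φ, u_j (H_{j^⊥} + t u_j - E - i ε)⁻¹ u_j φ⟩` for the configuration `q`. -/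
def siteForm (H₀ : L2 c l →ₗ.[ℂ] L2 c l) (φ : L2 c l) (ε : ℝ) (j : Fin d → ℤ)
    (q : (Fin d → ℤ) → ℝ) (E t : ℝ) : ℝ :=
  (inner ℂ φ (siteOp hu c l j (resolvent (siteFamily hu H₀ q j t)
    ((E : ℂ) + Complex.I * (ε : ℂ)) (siteOp hu c l j φ)))).im

/-- Makes the form a function of `(ω_k)_{k ≠ j}` alone, the variable on which the conditional law
depends. -/
theorem siteForm_congr (H₀ : L2 c l →ₗ.[ℂ] L2 c l) (φ : L2 c l) (ε : ℝ) {j : Fin d → ℤ}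
    {q q' : (Fin d → ℤ) → ℝ} (h : ∀ k, k ≠ j → q k = q' k) :
    siteForm hu H₀ φ ε j q = siteForm hu H₀ φ ε j q' := by
  have h1 : Function.update q j 0 = Function.update q' j 0 := by
    ext k
    by_cases hk : k = j
    · subst hk; simp
    · rw [Function.update_of_ne hk, Function.update_of_ne hk, h k hk]
  ext E t
  simp only [siteForm, siteFamily, h1]

variable {H₀ : L2 c l →ₗ.[ℂ] L2 c l} (hH₀ : IsSelfAdjoint H₀) (hu0 : ∀ᵐ x, 0 ≤ u x)
  {ε : ℝ} (hε : 0 < ε)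

include hH₀ hu0 hε

theorem siteForm_eq (φ : L2 c l) (j : Fin d → ℤ) (q : (Fin d → ℤ) → ℝ) (E t : ℝ) :
    siteForm hu H₀ φ ε j q E t = ε * ‖resolvent (siteFamily hu H₀ q j t)
      ((E : ℂ) + Complex.I * (ε : ℂ)) (siteOp hu c l j φ)‖ ^ 2 := by
  have hsym : ∀ x y, inner ℂ (siteOp hu c l j x) y = inner ℂ x (siteOp hu c l j y) :=
    fun x y => (isPositive_siteOp hu hu0 j).isSelfAdjoint.isSymmetric x y
  have hsa : IsSelfAdjoint (siteFamily hu H₀ q j t) := by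
    rw [siteFamily_eq]
    exact isSelfAdjoint_vadd hH₀ (isSelfAdjoint_sitePotential hu hu0 q j t)
  have hres := isResolventAt_resolvent hsa (z := (E : ℂ) + Complex.I * (ε : ℂ))
    (by simpa using hε.ne')
  rw [siteForm, ← hsym, hres.inner_im hsa]
  simp

theorem siteForm_nonneg (φ : L2 c l) (j : Fin d → ℤ) (q : (Fin d → ℤ) → ℝ) (E t : ℝ) :
    0 ≤ siteForm hu H₀ φ ε j q E t := by
  rw [siteForm_eq hu hH₀ hu0 hε]; positivity

theorem siteForm_le (φ : L2 c l) (j : Fin d → ℤ) (q : (Fin d → ℤ) → ℝ) (E t : ℝ) :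
    siteForm hu H₀ φ ε j q E t ≤ ε * (ε⁻¹ * ‖siteOp hu c l j φ‖) ^ 2 := by
  have hsa : IsSelfAdjoint (siteFamily hu H₀ q j t) := by
    rw [siteFamily_eq]
    exact isSelfAdjoint_vadd hH₀ (isSelfAdjoint_sitePotential hu hu0 q j t)
  have hres := isResolventAt_resolvent hsa (z := (E : ℂ) + Complex.I * (ε : ℂ))
    (by simpa using hε.ne')
  have h := hres.norm_apply_le hsa (siteOp hu c l j φ)
  have him : ((E : ℂ) + Complex.I * (ε : ℂ)).im = ε := by simp
  rw [him, abs_of_pos hε] at h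
  rw [siteForm_eq hu hH₀ hu0 hε]
  gcongr
  rwa [inv_mul_eq_div, le_div_iff₀ hε, mul_comm]

theorem continuous_siteForm {X : Type*} [TopologicalSpace X] (φ : L2 c l) (j : Fin d → ℤ)
    {q : X → (Fin d → ℤ) → ℝ} {E t : X → ℝ} (hq : ∀ k, k ≠ j → Continuous fun x => q x k)
    (hE : Continuous E) (ht : Continuous t) :
    Continuous fun x => siteForm hu H₀ φ ε j (q x) (E x) (t x) := by
  have hupd : ∀ k, Continuous fun x => (Function.update (q x) j 0 k : ℂ) := by
    intro k
    by_cases hk : k = j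
    · subst hk; simpa using continuous_const
    · simp only [Function.update_of_ne hk]
      exact Complex.continuous_ofReal.comp (hq k hk)
  have hB : Continuous fun x => sitePotential hu c l (q x) j (t x) := by
    unfold sitePotential
    exact ((Complex.continuous_ofReal.comp ht).smul continuous_const).add
      (continuous_finsetSum _ fun k _ => (hupd k).smul continuous_const)
  have hR := continuous_resolvent hH₀ (B := fun x => sitePotential hu c l (q x) j (t x))
    (fun x => isSelfAdjoint_sitePotential hu hu0 (q x) j (t x)) hB
    (z := fun x => (E x : ℂ) + Complex.I * (ε : ℂ))
    (fun x => by simpa using hε.ne') (by fun_prop)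
  simp only [siteForm, siteFamily_eq]
  fun_prop

theorem lintegral_siteForm_le (hu1 : ∀ᵐ x, u x ≤ 1) (φ : L2 c l) (j : Fin d → ℤ)
    (q : (Fin d → ℤ) → ℝ) (E : ℝ) (μ : Measure ℝ) [SFinite μ] :
    ∫⁻ t, ENNReal.ofReal (siteForm hu H₀ φ ε j q E t) ∂μ ≤
      ENNReal.ofReal (2 * Real.pi / ε * ‖φ‖ ^ 2) * ⨆ a : ℝ, μ (Icc a (a + ε)) := by
  have h := lintegral_resolvent_le (isSelfAdjoint_hamiltonian hu hu0 hH₀ (Function.update q j 0))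
    (isPositive_siteOp hu hu0 j) (norm_siteOp_le hu hu0 hu1 j) hε E φ μ
  rw [mul_right_comm, ← ENNReal.ofReal_mul (by positivity)] at h
  exact h

/-- The spectral projection of an interval of length `ε` is dominated by `siteForm`. The estimate
holds for every spectral family of the operator; by the spectral theorem there always is one, so the
default value of `spectralFamily` plays no role. -/
theorem re_inner_spectralFamily_le {Δ : Set ℝ} (hΔ : MeasurableSet Δ) {E₀ : ℝ}
    (hsub : Δ ⊆ Icc (E₀ - ε / 2) (E₀ + ε / 2)) (φ : L2 c l) {j : Fin d → ℤ}
    (hj : j ∈ latticePoints c l) (q : (Fin d → ℤ) → ℝ) :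
    (inner ℂ φ (siteOp hu c l j (spectralFamily (hamiltonian hu H₀ q) Δ
      (siteOp hu c l j φ)))).re ≤ 5 / 4 * ε * siteForm hu H₀ φ ε j q E₀ (q j) := by
  have hsym : ∀ x y, inner ℂ (siteOp hu c l j x) y = inner ℂ x (siteOp hu c l j y) :=
    fun x y => (isPositive_siteOp hu hu0 j).isSelfAdjoint.isSymmetric x y
  have hsa := isSelfAdjoint_hamiltonian hu hu0 hH₀ q
  by_cases hex : ∃ E, IsSpectralFamily (hamiltonian hu H₀ q) E
  · have hE : IsSpectralFamily (hamiltonian hu H₀ q) (spectralFamily (hamiltonian hu H₀ q)) := by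
      rw [spectralFamily, dif_pos hex]
      exact hex.choose_spec
    have h := hE.re_inner_apply_le hsa hΔ (half_pos hε) hε hsub
      (isResolventAt_resolvent hsa (by simpa using hε.ne')) (siteOp hu c l j φ)
    rw [hsym, hsym] at h
    rw [siteForm, siteFamily_self hu H₀ q hj]
    convert h using 2
    field_simp
    ring
  · have h0 : spectralFamily (hamiltonian hu H₀ q) Δ = 0 := by
      rw [spectralFamily, dif_neg hex]; rfl
    have := siteForm_nonneg hu hH₀ hu0 hε φ j q E₀ (q j)
    rw [h0]
    simp only [zero_apply, map_zero, inner_zero_right, Complex.zero_re]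
    positivity

end SiteOperators

/-! ### Integration against conditional laws. -/

section Probability

variable {Ω Ξ : Type*} [MeasurableSpace Ω] [MeasurableSpace Ξ]

theorem exists_subset_Icc_of_volume {Δ : Set ℝ} (hΔ : Δ.OrdConnected) {ε : ℝ} (hε : 0 < ε)
    (hvol : volume Δ = ENNReal.ofReal ε) : ∃ E₀, Δ ⊆ Icc (E₀ - ε / 2) (E₀ + ε / 2) := by
  have hne : Δ.Nonempty := by
    rw [nonempty_iff_ne_empty]
    rintro rfl
    rw [measure_empty, eq_comm, ENNReal.ofReal_eq_zero] at hvol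
    linarith
  have hdist : ∀ x ∈ Δ, ∀ y ∈ Δ, y ≤ x + ε := by
    intro x hx y hy
    have h := measure_mono (μ := volume) (hΔ.out hx hy)
    rw [hvol, Real.volume_Icc, ENNReal.ofReal_le_ofReal_iff hε.le] at h
    linarith
  obtain ⟨x₀, hx₀⟩ := hne
  have hbdd : BddAbove Δ := ⟨x₀ + ε, fun y hy => hdist x₀ hx₀ y hy⟩
  refine ⟨sSup Δ - ε / 2, fun x hx => ⟨?_, ?_⟩⟩
  · have := csSup_le ⟨x₀, hx₀⟩ (hdist x hx)
    linarith
  · have := le_csSup hbdd hx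
    linarith

/-- Integration of a bounded nonnegative function against a Markov kernel, an interval and a
probability measure, with the bound inherited from the kernel. -/
theorem integral_kernel_le (P : Measure Ω) [IsProbabilityMeasure P] (κ : Kernel Ξ ℝ)
    [IsMarkovKernel κ] {X : Ω → Ξ} (hX : Measurable X) {G : Ξ → ℝ → ℝ → ℝ}
    (hGm : Measurable fun p : (Ξ × ℝ) × ℝ => G p.1.1 p.1.2 p.2) {b : ℝ}
    (hG0 : ∀ x E t, 0 ≤ G x E t) (hGb : ∀ x E t, G x E t ≤ b) {Δ : Set ℝ} {ε : ℝ} (hε : 0 ≤ ε)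
    (hΔ : volume Δ = ENNReal.ofReal ε) {a s : ℝ} (ha : 0 ≤ a) (hs : 0 ≤ s) {S : Ξ → ℝ≥0∞}
    (hle : ∀ x E, ∫⁻ t, ENNReal.ofReal (G x E t) ∂κ x ≤ ENNReal.ofReal a * S x)
    (hS : ∫⁻ w, S (X w) ∂P ≤ ENNReal.ofReal s) :
    (∀ x E, Integrable (G x E) (κ x)) ∧
      (∀ x, IntegrableOn (fun E => ∫ t, G x E t ∂κ x) Δ) ∧
      Integrable (fun w => ∫ E in Δ, ∫ t, G (X w) E t ∂κ (X w)) P ∧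
      ∫ w, (∫ E in Δ, ∫ t, G (X w) E t ∂κ (X w)) ∂P ≤ a * ε * s := by
  have hfin : IsFiniteMeasure (volume.restrict Δ) :=
    ⟨by rw [Measure.restrict_apply_univ, hΔ]; exact ENNReal.ofReal_lt_top⟩
  have hGt : ∀ x E, Measurable (G x E) := fun x E =>
    hGm.comp ((measurable_const (a := (x, E))).prodMk measurable_id)
  have hGi : ∀ x E, Integrable (G x E) (κ x) := fun x E =>
    Integrable.of_bound (hGt x E).aestronglyMeasurable b
      (Filter.Eventually.of_forall fun t => by
        rw [Real.norm_of_nonneg (hG0 x E t)]; exact hGb x E t)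
  have hI : StronglyMeasurable fun p : Ξ × ℝ => ∫ t, G p.1 p.2 t ∂κ p.1 :=
    StronglyMeasurable.integral_kernel_prod_right (κ := κ.comap Prod.fst measurable_fst)
      (f := fun (p : Ξ × ℝ) t => G p.1 p.2 t) hGm.stronglyMeasurable
  have hI0 : ∀ x E, 0 ≤ ∫ t, G x E t ∂κ x := fun x E => integral_nonneg (hG0 x E)
  have hIb : ∀ x E, ∫ t, G x E t ∂κ x ≤ b := fun x E => by
    have := integral_mono (hGi x E) (integrable_const b) (hGb x E)
    simpa using this
  have hIi : ∀ x, IntegrableOn (fun E => ∫ t, G x E t ∂κ x) Δ := fun x =>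
    Integrable.of_bound
      (hI.comp_measurable (measurable_const.prodMk measurable_id)).aestronglyMeasurable b
      (Filter.Eventually.of_forall fun E => by
        rw [Real.norm_of_nonneg (hI0 x E)]; exact hIb x E)
  have hJ : StronglyMeasurable fun x => ∫ E in Δ, ∫ t, G x E t ∂κ x :=
    hI.integral_prod_right (f := fun x E => ∫ t, G x E t ∂κ x)
  have hJ0 : ∀ x, 0 ≤ ∫ E in Δ, ∫ t, G x E t ∂κ x := fun x => integral_nonneg (hI0 x)
  have hJb : ∀ x, ∫ E in Δ, ∫ t, G x E t ∂κ x ≤ (volume.restrict Δ).real Set.univ * b := fun x => by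
    have := integral_mono (hIi x) (integrable_const b) (hIb x)
    simpa using this
  have hJi : Integrable (fun w => ∫ E in Δ, ∫ t, G (X w) E t ∂κ (X w)) P :=
    Integrable.of_bound (hJ.comp_measurable hX).aestronglyMeasurable _
      (Filter.Eventually.of_forall fun w => by
        rw [Real.norm_of_nonneg (hJ0 (X w))]; exact hJb (X w))
  refine ⟨hGi, hIi, hJi, ?_⟩
  have hJle : ∀ x, ENNReal.ofReal (∫ E in Δ, ∫ t, G x E t ∂κ x) ≤
      ENNReal.ofReal (a * ε) * S x := by
    intro x
    rw [ofReal_integral_eq_lintegral_ofReal (hIi x) (Filter.Eventually.of_forall (hI0 x))]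
    calc ∫⁻ E in Δ, ENNReal.ofReal (∫ t, G x E t ∂κ x)
        = ∫⁻ E in Δ, ∫⁻ t, ENNReal.ofReal (G x E t) ∂κ x := lintegral_congr fun E =>
          ofReal_integral_eq_lintegral_ofReal (hGi x E) (Filter.Eventually.of_forall (hG0 x E))
      _ ≤ ∫⁻ _ in Δ, ENNReal.ofReal a * S x := lintegral_mono fun E => hle x E
      _ = ENNReal.ofReal (a * ε) * S x := by
          rw [setLIntegral_const, hΔ, ENNReal.ofReal_mul ha, mul_right_comm]
  rw [← ENNReal.ofReal_le_ofReal_iff (by positivity),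
    ofReal_integral_eq_lintegral_ofReal hJi (Filter.Eventually.of_forall fun w => hJ0 (X w))]
  calc ∫⁻ w, ENNReal.ofReal (∫ E in Δ, ∫ t, G (X w) E t ∂κ (X w)) ∂P
      ≤ ∫⁻ w, ENNReal.ofReal (a * ε) * S (X w) ∂P := lintegral_mono fun w => hJle (X w)
    -- Finiteness of the constant replaces measurability of `S`, which will be a supremum over
    -- uncountably many intervals.
    _ = ENNReal.ofReal (a * ε) * ∫⁻ w, S (X w) ∂P :=
        lintegral_const_mul' _ _ ENNReal.ofReal_ne_top
    _ ≤ ENNReal.ofReal (a * ε * s) := by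
        rw [ENNReal.ofReal_mul (p := a * ε) (by positivity)]
        gcongr

/-- Disintegration along the conditional distribution. -/
theorem lintegral_condDistrib (P : Measure Ω) [IsFiniteMeasure P] {X : Ω → Ξ} {Y : Ω → ℝ}
    (hX : Measurable X) (hY : Measurable Y) {g : Ξ × ℝ → ℝ≥0∞} (hg : Measurable g) :
    ∫⁻ w, g (X w, Y w) ∂P = ∫⁻ w, ∫⁻ t, g (X w, t) ∂condDistrib Y X P (X w) ∂P := by
  have hm : Measurable fun x => ∫⁻ t, g (x, t) ∂condDistrib Y X P x :=
    Measurable.lintegral_kernel_prod_right (f := fun x t => g (x, t)) hg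
  rw [← lintegral_map hg (hX.prodMk hY), ← compProd_map_condDistrib hY.aemeasurable,
    Measure.lintegral_compProd hg, lintegral_map hm hX]

/-- Only the majorant `g` has to be measurable; `f` will be the quadratic form of the spectral
projection, whose measurability in `w` is thereby not needed. -/
theorem lintegral_le_of_condDistrib_le (P : Measure Ω) [IsFiniteMeasure P] {X : Ω → Ξ}
    {Y : Ω → ℝ} (hX : Measurable X) (hY : Measurable Y) {g : Ξ × ℝ → ℝ≥0∞} (hg : Measurable g)
    {a b s : ℝ≥0∞} (ha : a ≠ ∞) (hb : b ≠ ∞) {S : Ξ → ℝ≥0∞}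
    (hle : ∀ x, ∫⁻ t, g (x, t) ∂condDistrib Y X P x ≤ a * S x) (hS : ∫⁻ w, S (X w) ∂P ≤ s)
    {f : Ω → ℝ≥0∞} (hf : ∀ w, f w ≤ b * g (X w, Y w)) :
    ∫⁻ w, f w ∂P ≤ b * (a * s) :=
  calc ∫⁻ w, f w ∂P ≤ ∫⁻ w, b * g (X w, Y w) ∂P := lintegral_mono hf
    _ = b * ∫⁻ w, ∫⁻ t, g (X w, t) ∂condDistrib Y X P (X w) ∂P := by
        rw [lintegral_const_mul' _ _ hb, lintegral_condDistrib P hX hY hg]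
    _ ≤ b * ∫⁻ w, a * S (X w) ∂P := by
        gcongr with w
        exact hle (X w)
    _ ≤ b * (a * s) := by
        rw [lintegral_const_mul' _ _ ha]
        gcongr

/-- Every term is at most `1`, so the supremum is finite and `toReal` in `sModulus` loses nothing.
-/
theorem lintegral_iSup_condLaw_le {d : ℕ} (P : Measure Ω) [IsProbabilityMeasure P]
    (ω : (Fin d → ℤ) → Ω → ℝ) (j : Fin d → ℤ) (ε : ℝ) :
    ∫⁻ w, ⨆ a : ℝ, condLaw P ω j w (Icc a (a + ε)) ∂P ≤ ENNReal.ofReal (sModulus P ω ε) := by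
  have hle : ∀ j, ∫⁻ w, ⨆ a : ℝ, condLaw P ω j w (Icc a (a + ε)) ∂P ≤ 1 := fun j => by
    calc ∫⁻ w, ⨆ a : ℝ, condLaw P ω j w (Icc a (a + ε)) ∂P ≤ ∫⁻ _, 1 ∂P :=
          lintegral_mono fun w => iSup_le fun a => by
            unfold condLaw; exact prob_le_one
      _ = 1 := by simp
  rw [sModulus, ENNReal.ofReal_toReal (ne_top_of_le_ne_top ENNReal.one_ne_top (iSup_le hle))]
  exact le_iSup (fun j => ∫⁻ w, ⨆ a : ℝ, condLaw P ω j w (Icc a (a + ε)) ∂P) j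

end Probability

end RandomSchrodinger

end

/-! ### The two averaged estimates. -/

theorem mainTheorem8 {d : ℕ} {Ω : Type*} [MeasurableSpace Ω]
    (P : MeasureTheory.Measure Ω) [MeasureTheory.IsProbabilityMeasure P]
    -- the random couplings, a bounded process over the lattice
    (ω : (Fin d → ℤ) → Ω → ℝ) (hω : ∀ j, Measurable (ω j))
    (m₀ M₀ : ℝ) (hbdd : ∀ j, ∀ᵐ w ∂P, ω j w ∈ Set.Icc m₀ M₀)
    -- the single-site potential
    (u : EuclideanSpace ℝ (Fin d) → ℝ)
    (hu : MeasureTheory.MemLp u ⊤ MeasureTheory.volume)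
    (hu_nonneg : ∀ᵐ x, 0 ≤ u x) (hu_le : ∀ᵐ x, u x ≤ 1)
    -- the background operator on a cube with periodic boundary conditions
    (A₀ : EuclideanSpace ℝ (Fin d) → EuclideanSpace ℝ (Fin d))
    (V₀ : EuclideanSpace ℝ (Fin d) → ℝ)
    (c : EuclideanSpace ℝ (Fin d)) (l : ℝ) (hl : 0 < l)
    (hA₀ : MeasureTheory.MemLp A₀ 2
      (MeasureTheory.volume.restrict (RandomSchrodinger.cube c l)))
    (H₀ : RandomSchrodinger.L2 c l →ₗ.[ℂ] RandomSchrodinger.L2 c l)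
    (hH₀ : RandomSchrodinger.IsPeriodicRestriction A₀ V₀ c l H₀)
    -- a site of the cube, a vector, and an energy interval of length `ε`
    (j : Fin d → ℤ) (hj : j ∈ RandomSchrodinger.latticePoints c l)
    (φ : RandomSchrodinger.L2 c l)
    (ε : ℝ) (hε : 0 < ε)
    (Δ : Set ℝ) (hΔ : Δ.OrdConnected) (hΔε : MeasureTheory.volume Δ = ENNReal.ofReal ε) :
    let μ : Ω → MeasureTheory.Measure ℝ := RandomSchrodinger.condLaw P ω j
    let uj := RandomSchrodinger.siteOp hu c l j
    let F : Ω → ℝ → ℝ → ℝ := fun w E t =>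
      (inner ℂ φ (uj (RandomSchrodinger.resolvent
        (RandomSchrodinger.siteFamily hu H₀ (fun k => ω k w) j t)
        ((E : ℂ) + Complex.I * (ε : ℂ)) (uj φ)))).im
    ((∀ w E, MeasureTheory.Integrable (F w E) (μ w)) ∧
      (∀ w, MeasureTheory.IntegrableOn (fun E => ∫ t, F w E t ∂(μ w)) Δ) ∧
      MeasureTheory.Integrable (fun w => ∫ E in Δ, ∫ t, F w E t ∂(μ w)) P ∧
      ∫ w, (∫ E in Δ, ∫ t, F w E t ∂(μ w)) ∂P
        ≤ 2 * Real.pi * RandomSchrodinger.sModulus P ω ε * ‖φ‖ ^ 2) ∧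
    ∫⁻ w, ENNReal.ofReal (inner ℂ φ (uj (RandomSchrodinger.spectralFamily
        (RandomSchrodinger.hamiltonian hu H₀ (fun k => ω k w)) Δ (uj φ)))).re ∂P
      ≤ ENNReal.ofReal (8 * RandomSchrodinger.sModulus P ω ε * ‖φ‖ ^ 2) := by
  intro μ uj F
  have hsa : IsSelfAdjoint H₀ := hH₀.isSelfAdjoint
  let X : Ω → ({k : Fin d → ℤ // k ≠ j} → ℝ) := fun w k => ω k w
  have hX : Measurable X := measurable_pi_lambda _ fun k => hω k
  -- The value at `j` is immaterial, since `siteFamily` resets that coupling.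
  let q : ({k : Fin d → ℤ // k ≠ j} → ℝ) → (Fin d → ℤ) → ℝ :=
    fun x k => if h : k ≠ j then x ⟨k, h⟩ else 0
  have hq : ∀ k, k ≠ j → Continuous fun x => q x k := fun k hk => by
    simp only [q, dif_pos hk]
    exact continuous_apply _
  let G : ({k : Fin d → ℤ // k ≠ j} → ℝ) → ℝ → ℝ → ℝ := fun x E t =>
    RandomSchrodinger.siteForm hu H₀ φ ε j (q x) E t
  have hFG : ∀ w, F w = G (X w) := fun w =>
    RandomSchrodinger.siteForm_congr hu H₀ φ ε fun k hk => by simp only [q, dif_pos hk, X]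
  have hGc : Continuous fun p : (({k : Fin d → ℤ // k ≠ j} → ℝ) × ℝ) × ℝ =>
      G p.1.1 p.1.2 p.2 :=
    RandomSchrodinger.continuous_siteForm hu hsa hu_nonneg hε φ j
      (fun k hk => (hq k hk).comp (continuous_fst.comp continuous_fst))
      (continuous_snd.comp continuous_fst) continuous_snd
  have hs0 : 0 ≤ RandomSchrodinger.sModulus P ω ε := ENNReal.toReal_nonneg
  have hS : ∫⁻ w, ⨆ a : ℝ, condDistrib (ω j) X P (X w) (Icc a (a + ε)) ∂P ≤
      ENNReal.ofReal (RandomSchrodinger.sModulus P ω ε) :=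
    RandomSchrodinger.lintegral_iSup_condLaw_le P ω j ε
  have hle : ∀ x E, ∫⁻ t, ENNReal.ofReal (G x E t) ∂condDistrib (ω j) X P x ≤
      ENNReal.ofReal (2 * Real.pi / ε * ‖φ‖ ^ 2) *
        ⨆ a : ℝ, condDistrib (ω j) X P x (Icc a (a + ε)) := fun x E =>
    RandomSchrodinger.lintegral_siteForm_le hu hsa hu_nonneg hε hu_le φ j (q x) E _
  obtain ⟨h1, h2, h3, h4⟩ := RandomSchrodinger.integral_kernel_le P (condDistrib (ω j) X P) hX
    hGc.measurable
    (fun x => RandomSchrodinger.siteForm_nonneg hu hsa hu_nonneg hε φ j (q x))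
    (fun x => RandomSchrodinger.siteForm_le hu hsa hu_nonneg hε φ j (q x)) hε.le hΔε
    (by positivity) hs0 hle hS
  refine ⟨⟨fun w E => ?_, fun w => ?_, ?_, ?_⟩, ?_⟩
  · rw [hFG]; exact h1 (X w) E
  · simp only [hFG]; exact h2 (X w)
  · simp only [hFG]; exact h3
  · simp only [hFG]
    refine h4.trans (le_of_eq ?_)
    field_simp
  · obtain ⟨E₀, hsub⟩ := RandomSchrodinger.exists_subset_Icc_of_volume hΔ hε hΔε
    have hg : Measurable fun p : ({k : Fin d → ℤ // k ≠ j} → ℝ) × ℝ =>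
        ENNReal.ofReal (G p.1 E₀ p.2) := by
      have hc : Continuous fun p : ({k : Fin d → ℤ // k ≠ j} → ℝ) × ℝ => G p.1 E₀ p.2 :=
        RandomSchrodinger.continuous_siteForm hu hsa hu_nonneg hε φ j
          (fun k hk => (hq k hk).comp continuous_fst) continuous_const continuous_snd
      exact hc.measurable.ennreal_ofReal
    have hspec : ∀ w, ENNReal.ofReal (inner ℂ φ (uj (RandomSchrodinger.spectralFamily
        (RandomSchrodinger.hamiltonian hu H₀ (fun k => ω k w)) Δ (uj φ)))).re ≤
        ENNReal.ofReal (5 / 4 * ε) * ENNReal.ofReal (G (X w) E₀ (ω j w)) := by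
      intro w
      have hw := RandomSchrodinger.re_inner_spectralFamily_le hu hsa hu_nonneg hε
        hΔ.measurableSet hsub φ hj (fun k => ω k w)
      have hw' : RandomSchrodinger.siteForm hu H₀ φ ε j (fun k => ω k w) E₀ (ω j w) =
        G (X w) E₀ (ω j w) := congrFun (congrFun (hFG w) E₀) (ω j w)
      rw [hw'] at hw
      rw [← ENNReal.ofReal_mul (by positivity)]
      exact ENNReal.ofReal_le_ofReal hw
    have hfin := RandomSchrodinger.lintegral_le_of_condDistrib_le P hX (hω j) hg
      ENNReal.ofReal_ne_top ENNReal.ofReal_ne_top (fun x => hle x E₀) hS hspec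
    refine hfin.trans ?_
    rw [← ENNReal.ofReal_mul (by positivity), ← ENNReal.ofReal_mul (by positivity)]
    refine ENNReal.ofReal_le_ofReal ?_
    -- The factor `5ε/4` from the projection bound meets `2π/ε` from averaging at the single energy
    -- `E₀`; `π < 3.15` then gives `5π/2 < 8`.
    have h5 : 5 / 4 * ε * (2 * Real.pi / ε * ‖φ‖ ^ 2 * RandomSchrodinger.sModulus P ω ε) =
        5 / 2 * Real.pi * (RandomSchrodinger.sModulus P ω ε * ‖φ‖ ^ 2) := by
      field_simp
      ring
    have h6 : 0 ≤ RandomSchrodinger.sModulus P ω ε * ‖φ‖ ^ 2 := by positivity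
    rw [h5, mul_assoc 8]
    exact mul_le_mul_of_nonneg_right (by linarith [Real.pi_lt_d2]) h6
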